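/- All graphs are finite, simple and undirected; $N[v]$ is the closed neighbourhood of $v$. A growth process starts from a single vertex $u_0$ (the initiator). In each slot, every present vertex $u$ gives birth to at most one new vertex $u'$; $u'$ is joined to $u$ and to an arbitrary set of neighbours of $u$ in the graph present before the slot; then some edges may be deleted, without disconnecting the graph. Deleted edges are called excess edges. A growth schedule for $G$ of $k$ slots is such a process that yields exactly $G$ after $k$ slots. In a graph $H$, a vertex $w\ne v$ with $N[v]\subseteq N[w]$ is a candidate parent of $v$, and $v$ is then a candidate. A set $L$ of candidates of $H$ is valid if $|L|=|V(H)|/2$, $L$ is independent, and there is a perfect matching between $L$ and $V(H)\setminus L$ that matches each vertex of $L$ with one of its candidate parents. The fast growth algorithm, on a graph $G$ with $2^\delta$ vertices, computes the slots from the last to the first. In each of $\delta$ rounds, with current graph $H$, it looks for a perfect matching $M=\{u_iv_i\}$ of $H$ each edge of which joins a candidate to one of its candidate parents; if there is none it answers "no". It forms a 2-SAT formula $\varphi$ with a variable $x_i$ for each $u_iv_i\in M$ and the clauses: $(\neg x_i)$ if $N[u_i]\subseteq N[v_i]\not\subseteq N[u_i]$; $(x_i)$ if $N[v_i]\subseteq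 N[u_i]\not\subseteq N[v_i]$; $(x_i\vee x_j)$ for every edge $u_iu_j$; $(\neg x_i\vee\neg x_j)$ for every edge $v_iv_j$; $(x_i\vee\neg x_j)$ for every edge $u_iv_j\notin M$. If $\varphi$ is unsatisfiable it answers "no". Otherwise it takes a satisfying assignment and lets $L$ consist of $v_i$ for each true $x_i$ and of $u_i$ for each false $x_i$; in the slot found, each vertex of $L$ is born from its partner in $M$ and joined to all its neighbours in $H$. It continues with $H-L$. The single vertex left after $\delta$ rounds is the initiator, and the algorithm outputs the schedule. **Theorem.** 1. For every graph $H$ and every perfect matching $M$ of $H$ as above, each satisfying assignment of $\varphi$ gives a valid set $L$, and $\varphi$ is satisfiable if $H$ has a valid set. If $H$ has a valid set, then such an $M$ exists. 2. For every $\delta\ge 0$ and every graph $G$ on $n=2^\delta$ vertices, whichever matchings and satisfying assignments are chosen, the fast growth algorithm outputs a growth schedule for $G$ of $\log_2 n=\delta$ slots and zero excess edges if one exists, and answers "no" otherwise. 3. The fast growth algorithm can be carried out in polynomial time: there are a random access machine program (unit-cost addition and truncated subtraction) and a polynomial $p$ such that, for every $\delta\ge 0$ and every graph $G$ on $n=2^\delta$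 vertices given by its adjacency matrix, the program halts within $p(n)$ steps and outputs an answer that the fast growth algorithm can give on $G$. -/

import Mathlib

namespace GraphGrowth

/-! ### Growing graphs and growth schedules (edge-activation distance `d = 2`) -/

/-- An instance `G_t = (V_t, E_t)` of a growing graph whose vertices are drawn from `V`. -/
structure GraphInstance (V : Type) where
  verts : Finset V
  edges : Finset (Sym2 V)

/-- What a growth process does in one slot. A triple `(u, v, A)` in `births` means that `u` gives
birth to the new vertex `v`, and that the edges activated for `v` are `{v w : w ∈ A}`. -/
structure Slot (V : Type) where
  births : Finset (V × V × Finset V)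
  deleted : Finset (Sym2 V)

section Growing

variable {V : Type} [DecidableEq V]

/-- The set `V_t⁺` of vertices generated in the slot. -/
def Slot.generated (S : Slot V) : Finset V :=
  S.births.image fun b => b.2.1

/-- The set `E_t⁺` of edges activated in the slot. -/
def Slot.activated (S : Slot V) : Finset (Sym2 V) :=
  S.births.biUnion fun b => b.2.2.image fun w => s(b.2.1, w)

/-- The graph after the generation and activation operations, before any deletion. -/
def GraphInstance.beforeDeletion (H : GraphInstance V) (S : Slot V) : GraphInstance V :=
  ⟨H.verts ∪ S.generated, H.edges ∪ S.activated⟩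

/-- The graph at the end of the slot. -/
def GraphInstance.next (H : GraphInstance V) (S : Slot V) : GraphInstance V :=
  ⟨H.verts ∪ S.generated, (H.edges ∪ S.activated) \ S.deleted⟩

/-- The simple graph on `H.verts` with edge set `H.edges` is connected. -/
def GraphInstance.IsConnected (H : GraphInstance V) : Prop :=
  ((SimpleGraph.fromEdgeSet (H.edges : Set (Sym2 V))).induce (H.verts : Set V)).Connected

/-- The slot `S` respects the rules of the process when the current instance is `H`. -/
structure Slot.Admissible (S : Slot V) (H : GraphInstance V) : Prop where
  /-- Parents are present and children are new. -/
  parent_mem : ∀ u v A, (u, v, A) ∈ S.births → u ∈ H.verts ∧ v ∉ H.verts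
  /-- Every vertex generates at most one new vertex in the slot. -/
  parent_unique : ∀ b ∈ S.births, ∀ b' ∈ S.births, b.1 = b'.1 → b = b'
  /-- Every new vertex is generated once. -/
  child_unique : ∀ b ∈ S.births, ∀ b' ∈ S.births, b.2.1 = b'.2.1 → b = b'
  /-- The new vertex is joined to its parent. -/
  parent_edge : ∀ u v A, (u, v, A) ∈ S.births → u ∈ A
  /-- All its other activated edges go to vertices of `H` at distance at most `d - 1 = 1` from
  the parent in `H`. -/
  activation : ∀ u v A, (u, v, A) ∈ S.births → ∀ w ∈ A, w ∈ H.verts ∧ (w = u ∨ s(u, w) ∈ H.edges)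
  /-- Only existing edges are deleted. -/
  deleted_subset : S.deleted ⊆ H.edges ∪ S.activated
  /-- The deletion does not disconnect the graph. -/
  connected : (H.beforeDeletion S).IsConnected → (H.next S).IsConnected

/-- Starting from the instance `H`, the slots in the list can be executed one after the other, and
the final instance is `K`. -/
def GrowsFrom : GraphInstance V → List (Slot V) → GraphInstance V → Prop
  | H, [], K => K = H
  | H, S :: l, K => S.Admissible H ∧ GrowsFrom (H.next S) l K

end Growing

/-- The data of a growth process: the initiator `u₀`, and the slots in chronological order. -/
structure Schedule (V : Type) where
  initiator : V
  slots : List (Slot V)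

/-- The number of excess edges: the total number of deleted edges. -/
def Schedule.excess {V : Type} (σ : Schedule V) : ℕ :=
  (σ.slots.map fun S => S.deleted.card).sum

/-- `σ` is a growth schedule for `G`: executed from the one-vertex graph on the initiator, it
obeys the rules of the process and its final instance is `G`. -/
def Schedule.IsScheduleFor {V : Type} [Fintype V] [DecidableEq V]
    (σ : Schedule V) (G : SimpleGraph V) : Prop :=
  ∃ K : GraphInstance V, GrowsFrom ⟨{σ.initiator}, ∅⟩ σ.slots K ∧
    K.verts = Finset.univ ∧ (K.edges : Set (Sym2 V)) = G.edgeSet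

/-- The correct answers to the question whether `G` has a growth schedule of `k` slots and zero
excess edges: such a schedule if there is one, and `none` ("no") otherwise. -/
def IsCorrectAnswer {V : Type} [Fintype V] [DecidableEq V]
    (G : SimpleGraph V) (k : ℕ) : Option (Schedule V) → Prop
  | some σ => σ.IsScheduleFor G ∧ σ.slots.length = k ∧ σ.excess = 0
  | none => ¬ ∃ σ : Schedule V, σ.IsScheduleFor G ∧ σ.slots.length = k ∧ σ.excess = 0

/-! ### The fast growth algorithm

Throughout, `W` is the set of vertices of `G` that have not been removed yet; the current graph is
the subgraph `G[W]` of `G` induced by `W`. -/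

section FastGrowth

variable {V : Type}

/-- In `G[W]`, the vertex `v` is a candidate vertex with candidate parent `w`, that is,
`w ≠ v` and `N[v] ⊆ N[w]`. -/
def IsCandidateParent (G : SimpleGraph V) (W : Finset V) (w v : V) : Prop :=
  w ∈ W ∧ v ∈ W ∧ w ≠ v ∧ ∀ x ∈ W, (x = v ∨ G.Adj v x) → (x = w ∨ G.Adj w x)

/-- `L` is a valid set of candidates of `G[W]`: it consists of half of the vertices, which are
candidate vertices, it is independent, and its vertices can be matched with distinct candidate
parents outside `L`. -/
def IsValid (G : SimpleGraph V) (W L : Finset V) : Prop :=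
  L ⊆ W ∧ (∀ v ∈ L, ∃ w, IsCandidateParent G W w v) ∧ 2 * L.card = W.card ∧
    (∀ v ∈ L, ∀ w ∈ L, ¬ G.Adj v w) ∧
    ∃ p : V → V, Set.InjOn p (L : Set V) ∧ ∀ v ∈ L, p v ∉ L ∧ IsCandidateParent G W (p v) v

/-- The edges `u_i v_i`, where `(u_i, v_i) = M i`, form a perfect matching of `G[W]`, and each of
them joins a candidate vertex to one of its candidate parents. -/
def IsCandidateMatching (G : SimpleGraph V) (W : Finset V) {m : ℕ} (M : Fin m → V × V) : Prop :=
  (∀ i, (M i).1 ∈ W ∧ (M i).2 ∈ W ∧ G.Adj (M i).1 (M i).2 ∧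
    (IsCandidateParent G W (M i).1 (M i).2 ∨ IsCandidateParent G W (M i).2 (M i).1)) ∧
  ∀ x ∈ W, ∃! i, x = (M i).1 ∨ x = (M i).2

/-- A literal over `x_0, …, x_{m-1}`: `(i, true)` is `x_i` and `(i, false)` is `¬ x_i`. -/
abbrev Literal (m : ℕ) := Fin m × Bool

/-- A 2-SAT formula: a set of clauses with two literals (a clause with one literal repeats it). -/
abbrev TwoSat (m : ℕ) := Set (Literal m × Literal m)

/-- The truth assignment `τ` satisfies the formula `φ`. -/
def Satisfies {m : ℕ} (τ : Fin m → Bool) (φ : TwoSat m) : Prop :=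
  ∀ c ∈ φ, τ c.1.1 = c.1.2 ∨ τ c.2.1 = c.2.2

/-- The 2-SAT formula of a candidate matching `M`. The variable `x_i` is true when `v_i` is chosen
as the child of `u_i`, and false when `u_i` is chosen as the child of `v_i`. -/
def formula (G : SimpleGraph V) (W : Finset V) {m : ℕ} (M : Fin m → V × V) : TwoSat m :=
  {c | ∃ i, c = ((i, false), (i, false)) ∧
      IsCandidateParent G W (M i).2 (M i).1 ∧ ¬ IsCandidateParent G W (M i).1 (M i).2} ∪
  {c | ∃ i, c = ((i, true), (i, true)) ∧
      IsCandidateParent G W (M i).1 (M i).2 ∧ ¬ IsCandidateParent G W (M i).2 (M i).1} ∪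
  {c | ∃ i j, c = ((i, true), (j, true)) ∧ G.Adj (M i).1 (M j).1} ∪
  {c | ∃ i j, c = ((i, false), (j, false)) ∧ G.Adj (M i).2 (M j).2} ∪
  {c | ∃ i j, c = ((i, true), (j, false)) ∧ i ≠ j ∧ G.Adj (M i).1 (M j).2}

/-- The endpoint of the `i`-th matching edge chosen as a child by `τ`. -/
def childOf {m : ℕ} (M : Fin m → V × V) (τ : Fin m → Bool) (i : Fin m) : V :=
  if τ i then (M i).2 else (M i).1

/-- The other endpoint of the `i`-th matching edge. -/
def parentOf {m : ℕ} (M : Fin m → V × V) (τ : Fin m → Bool) (i : Fin m) : V :=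
  if τ i then (M i).1 else (M i).2

variable [DecidableEq V]

/-- The set `L` of all children chosen by `τ`. -/
def chosen {m : ℕ} (M : Fin m → V × V) (τ : Fin m → Bool) : Finset V :=
  Finset.univ.image (childOf M τ)

open scoped Classical in
/-- The slot in which every chosen child is born from its partner in the matching and is joined to
all its neighbours in `G[W]`; no edge is deleted. -/
noncomputable def matchingSlot (G : SimpleGraph V) (W : Finset V) {m : ℕ} (M : Fin m → V × V)
    (τ : Fin m → Bool) : Slot V where
  births := Finset.univ.image fun i =>
    (parentOf M τ i, childOf M τ i, W.filter fun w => G.Adj (childOf M τ i) w)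
  deleted := ∅

/-- `FastGrowth G k W out`: the fast growth algorithm, run on `G[W]` with `k` slots left to
compute, can return `out`. The choices left open are those of the perfect matching and of the
satisfying assignment. -/
inductive FastGrowth (G : SimpleGraph V) : ℕ → Finset V → Option (Schedule V) → Prop
  /-- A single vertex is left: it becomes the initiator. -/
  | done (u : V) : FastGrowth G 0 {u} (some ⟨u, []⟩)
  /-- There is no suitable perfect matching: the answer is "no". -/
  | noMatching (k : ℕ) (W : Finset V)
      (h : ¬ ∃ (m : ℕ) (M : Fin m → V × V), IsCandidateMatching G W M) :
      FastGrowth G (k + 1) W none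
  /-- The formula is not satisfiable: the answer is "no". -/
  | unsatisfiable (k : ℕ) (W : Finset V) (m : ℕ) (M : Fin m → V × V)
      (hM : IsCandidateMatching G W M)
      (h : ¬ ∃ τ : Fin m → Bool, Satisfies τ (formula G W M)) :
      FastGrowth G (k + 1) W none
  /-- The children chosen by a satisfying assignment are removed, the algorithm continues with the
  remaining graph, and the slot found now is appended to the schedule found for that graph. -/
  | step (k : ℕ) (W : Finset V) (m : ℕ) (M : Fin m → V × V) (τ : Fin m → Bool)
      (out : Option (Schedule V)) (hM : IsCandidateMatching G W M)
      (hτ : Satisfies τ (formula G W M)) (hrest : FastGrowth G k (W \ chosen M τ) out) :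
      FastGrowth G (k + 1) W
        (out.map fun σ => ⟨σ.initiator, σ.slots ++ [matchingSlot G W M τ]⟩)

end FastGrowth

/-! ### Random access machines with a step count

Structured programs over registers and two-dimensional arrays of natural numbers. The arithmetic
operations are addition and truncated subtraction, at unit cost, so that polynomially many steps
here amount to polynomial time on a Turing machine. -/

/-- The memory: register `i` holds `reg i`, and array `a` holds `arr a i j` at position
`(i, j)`. -/
structure Memory where
  reg : ℕ → ℕ
  arr : ℕ → ℕ → ℕ → ℕ

/-- Expressions: constants, registers, array entries, sums, truncated differences. -/
inductive Expr : Type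
  | const (c : ℕ)
  | reg (i : ℕ)
  | get (a : ℕ) (e₁ e₂ : Expr)
  | add (e₁ e₂ : Expr)
  | sub (e₁ e₂ : Expr)

/-- The value of an expression. -/
def Expr.eval (s : Memory) : Expr → ℕ
  | const c => c
  | reg i => s.reg i
  | get a e₁ e₂ => s.arr a (e₁.eval s) (e₂.eval s)
  | add e₁ e₂ => e₁.eval s + e₂.eval s
  | sub e₁ e₂ => e₁.eval s - e₂.eval s

/-- The number of steps needed to evaluate an expression. -/
def Expr.cost : Expr → ℕ
  | const _ => 1
  | reg _ => 1
  | get _ e₁ e₂ => e₁.cost + e₂.cost + 1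
  | add e₁ e₂ => e₁.cost + e₂.cost + 1
  | sub e₁ e₂ => e₁.cost + e₂.cost + 1

/-- Programs. A test is passed when its value is nonzero. -/
inductive Program : Type
  | skip
  | setReg (i : ℕ) (e : Expr)
  | setArr (a : ℕ) (e₁ e₂ e : Expr)
  | seq (P Q : Program)
  | ifThenElse (e : Expr) (P Q : Program)
  | while (e : Expr) (P : Program)

/-- Writing `x` to register `i`. -/
def Memory.writeReg (s : Memory) (i x : ℕ) : Memory :=
  { s with reg := Function.update s.reg i x }

/-- Writing `x` to position `(i, j)` of array `a`. -/
def Memory.writeArr (s : Memory) (a i j x : ℕ) : Memory :=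
  { s with arr := fun a' i' j' => if a' = a ∧ i' = i ∧ j' = j then x else s.arr a' i' j' }

/-- `Exec P s t s'`: started in memory `s`, the program `P` halts after exactly `t` steps in
memory `s'`. -/
inductive Exec : Program → Memory → ℕ → Memory → Prop
  | skip (s : Memory) : Exec .skip s 1 s
  | setReg (i : ℕ) (e : Expr) (s : Memory) :
      Exec (.setReg i e) s (e.cost + 1) (s.writeReg i (e.eval s))
  | setArr (a : ℕ) (e₁ e₂ e : Expr) (s : Memory) :
      Exec (.setArr a e₁ e₂ e) s (e₁.cost + e₂.cost + e.cost + 1)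
        (s.writeArr a (e₁.eval s) (e₂.eval s) (e.eval s))
  | seq {P Q : Program} {s s' s'' : Memory} {t t' : ℕ} (h : Exec P s t s')
      (h' : Exec Q s' t' s'') : Exec (.seq P Q) s (t + t') s''
  | ifTrue {e : Expr} {P Q : Program} {s s' : Memory} {t : ℕ} (he : e.eval s ≠ 0)
      (h : Exec P s t s') : Exec (.ifThenElse e P Q) s (e.cost + 1 + t) s'
  | ifFalse {e : Expr} {P Q : Program} {s s' : Memory} {t : ℕ} (he : e.eval s = 0)
      (h : Exec Q s t s') : Exec (.ifThenElse e P Q) s (e.cost + 1 + t) s'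
  | whileTrue {e : Expr} {P : Program} {s s' s'' : Memory} {t t' : ℕ} (he : e.eval s ≠ 0)
      (h : Exec P s t s') (h' : Exec (.while e P) s' t' s'') :
      Exec (.while e P) s (e.cost + 1 + t + t') s''
  | whileFalse {e : Expr} {P : Program} {s : Memory} (he : e.eval s = 0) :
      Exec (.while e P) s (e.cost + 1) s

open scoped Classical in
/-- The initial memory for the input graph `G` on `{0, …, n-1}`: register `0` holds `n`, array `0`
holds the adjacency matrix of `G`, and everything else is `0`. -/
noncomputable def inputMemory {n : ℕ} (G : SimpleGraph (Fin n)) : Memory where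
  reg := fun i => if i = 0 then n else 0
  arr := fun a u v =>
    if a = 0 ∧ ∃ (hu : u < n) (hv : v < n), G.Adj ⟨u, hu⟩ ⟨v, hv⟩ then 1 else 0

/-- The final memory `s` represents the answer. For "no", register `0` holds `0`. For a schedule,
register `0` holds `1`, register `1` the initiator, register `2` the number of slots, and
* array `1` at `(v, 0)` holds the number (counted from `1`) of the slot in which `v` is born,
* array `2` at `(v, 0)` holds the parent of `v`,
* array `3` at `(v, w)` holds `1` exactly when the edge `vw` is activated at the birth of `v`,
* array `4` at `(u, v)` holds the number of the slot in which the edge `uv` is deleted. -/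
def Represents {n : ℕ} (s : Memory) : Option (Schedule (Fin n)) → Prop
  | none => s.reg 0 = 0
  | some σ => s.reg 0 = 1 ∧ s.reg 1 = σ.initiator ∧ s.reg 2 = σ.slots.length ∧
      ∀ (t : ℕ) (ht : t < σ.slots.length),
        (∀ (u v : Fin n) (A : Finset (Fin n)), (u, v, A) ∈ (σ.slots[t]).births ↔
          s.arr 1 v 0 = t + 1 ∧ s.arr 2 v 0 = u ∧ ∀ w : Fin n, w ∈ A ↔ s.arr 3 v w = 1) ∧
        ∀ u v : Fin n, s(u, v) ∈ (σ.slots[t]).deleted ↔ s.arr 4 u v = t + 1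

end GraphGrowth

open GraphGrowth

/-! Inclusion of closed neighbourhoods is a preorder on the vertices of `G[W]`, and comparable
distinct vertices are adjacent. In a valid set `L`, independence therefore makes the vertices
pairwise incomparable. By counting, every vertex outside `L` is the parent of exactly one vertex of
`L`. So `L` contains exactly one vertex from each minimal twin class (`IsValid.isTransversal`). Two
such transversals differ by exchanging twins, which is an automorphism of `G[W]`
(`IsTransversal.exists_perm`). Hence one transversal is valid if and only if all are, and the graphs
left after removing different valid sets are isomorphic: no choice of the algorithm can spoil a
later round (`Dismantles.sdiff`).

For a fixed matching `M`, an independent set of half the vertices contains exactly one endpoint of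
each edge, so it is a truth assignment. The two-literal clauses express independence. The unit
clauses express that the chosen endpoint is the dominated one, which holds for valid sets by
minimality (`IsCandidateMatching.isValid_chosen`, `IsValid.exists_satisfies`).

Schedules and valid sets correspond as follows. Removing a valid set is the reverse of an admissible
slot without deletions (`FastGrowth.growsFrom`). Conversely, a slot at most doubles the number of
vertices, so `δ` slots reach `2 ^ δ` vertices only if every slot doubles it, and without deletions
the newborn vertices then form a valid set (`GrowsFrom.dismantles`).

For polynomial time the program needs neither general matching nor a 2-SAT solver. It takes the
least vertex of each minimal twin class as `L`, matches `L` with its candidate parents by a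
bipartite auction, and checks that the result is a valid set. On success the matching found, with
the all-true assignment, is a legal choice of the algorithm. On failure no valid set exists, so "no"
is a legal answer (`Solver.matching_spec`, `Solver.Stage.round`). The auction ends within `n * n`
bids because prices stay below `n` whenever all bidders can be served
(`IsAuctionState.exists_cheap`). Running times come from a language of counted loops whose cost is
bounded by a polynomial computed from the syntax (`LoopProgram.exists_exec`). -/

namespace GraphGrowth

/-! ### Valid sets and twin classes -/

section ValidSets

variable {V : Type} {G : SimpleGraph V} {W : Finset V}

/-- The closed neighbourhoods of `v` and `w` in `G[W]` satisfy `N[v] ⊆ N[w]`. -/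
def NbhdLE (G : SimpleGraph V) (W : Finset V) (v w : V) : Prop :=
  v ∈ W ∧ w ∈ W ∧ ∀ x ∈ W, (x = v ∨ G.Adj v x) → (x = w ∨ G.Adj w x)

theorem isCandidateParent_iff {v w : V} :
    IsCandidateParent G W w v ↔ w ≠ v ∧ NbhdLE G W v w := by
  unfold IsCandidateParent NbhdLE; tauto

theorem NbhdLE.refl {v : V} (hv : v ∈ W) : NbhdLE G W v v := ⟨hv, hv, fun _ _ h => h⟩

theorem NbhdLE.trans {u v w : V} (h : NbhdLE G W u v) (h' : NbhdLE G W v w) : NbhdLE G W u w :=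
  ⟨h.1, h'.2.1, fun x hx hux => h'.2.2 x hx (h.2.2 x hx hux)⟩

theorem NbhdLE.eq_or_adj {v w : V} (h : NbhdLE G W v w) : v = w ∨ G.Adj w v :=
  h.2.2 v h.1 (Or.inl rfl)

theorem IsCandidateParent.nbhdLE {v w : V} (h : IsCandidateParent G W w v) : NbhdLE G W v w :=
  (isCandidateParent_iff.1 h).2

theorem IsCandidateParent.adj {v w : V} (h : IsCandidateParent G W w v) : G.Adj w v :=
  h.nbhdLE.eq_or_adj.resolve_left fun e => h.2.2.1 e.symm

/-- `L` contains exactly one vertex of every minimal twin class of `G[W]`. -/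
structure IsTransversal (G : SimpleGraph V) (W L : Finset V) : Prop where
  subset : L ⊆ W
  exists_le : ∀ x ∈ W, ∃ v ∈ L, NbhdLE G W v x
  antichain : ∀ v ∈ L, ∀ w ∈ L, NbhdLE G W v w → v = w

/-- Some member of `L` lies below `x`, hence below `v`, and the antichain property identifies it
with `v`. Thus members of a transversal are minimal up to twins. -/
theorem IsTransversal.ge_of_le {L : Finset V} (hL : IsTransversal G W L) {v x : V} (hv : v ∈ L)
    (h : NbhdLE G W x v) : NbhdLE G W v x := by
  obtain ⟨l, hl, hlx⟩ := hL.exists_le x h.1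
  rwa [← hL.antichain l hl v hv (hlx.trans h)]

theorem IsTransversal.exists_twin {L L' : Finset V} (hL : IsTransversal G W L)
    (hL' : IsTransversal G W L') {v : V} (hv : v ∈ L) :
    ∃ w ∈ L', NbhdLE G W v w ∧ NbhdLE G W w v := by
  obtain ⟨w, hw, hwv⟩ := hL'.exists_le v (hL.subset hv)
  exact ⟨w, hw, hL.ge_of_le hv hwv, hwv⟩

/-- A permutation that restricts to an isomorphism from `G[W]` to the subgraph of `G` induced by
the image of `W`. -/
def PreservesAdj (G : SimpleGraph V) (W : Finset V) (f : V ≃ V) : Prop :=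
  ∀ x ∈ W, ∀ y ∈ W, (G.Adj (f x) (f y) ↔ G.Adj x y)

theorem PreservesAdj.mono {W' : Finset V} {f : V ≃ V} (hf : PreservesAdj G W f) (h : W' ⊆ W) :
    PreservesAdj G W' f := fun x hx y hy => hf x (h hx) y (h hy)

theorem PreservesAdj.isCandidateParent {f : V ≃ V} (hf : PreservesAdj G W f) {v w : V}
    (h : IsCandidateParent G W w v) :
    IsCandidateParent G (W.map f.toEmbedding) (f w) (f v) := by
  obtain ⟨hw, hv, hne, hsub⟩ := h
  refine ⟨by simpa using hw, by simpa using hv, by simpa using hne, ?_⟩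
  intro x hx hvx
  obtain ⟨y, hy, rfl⟩ := Finset.mem_map.1 hx
  simp only [Equiv.coe_toEmbedding, EmbeddingLike.apply_eq_iff_eq] at hvx ⊢
  rw [hf w hw y hy]
  rw [hf v hv y hy] at hvx
  exact hsub y hy hvx

theorem IsValid.map {f : V ≃ V} (hf : PreservesAdj G W f) {L : Finset V} (h : IsValid G W L) :
    IsValid G (W.map f.toEmbedding) (L.map f.toEmbedding) := by
  obtain ⟨hLW, hc, hcard, hind, p, hp, hpL⟩ := h
  refine ⟨by simpa using hLW, ?_, by simpa using hcard, ?_, fun x => f (p (f.symm x)), ?_, ?_⟩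
  · intro v hv
    obtain ⟨x, hx, rfl⟩ := Finset.mem_map.1 hv
    obtain ⟨w, hw⟩ := hc x hx
    exact ⟨f w, hf.isCandidateParent hw⟩
  · intro v hv w hw
    obtain ⟨x, hx, rfl⟩ := Finset.mem_map.1 hv
    obtain ⟨y, hy, rfl⟩ := Finset.mem_map.1 hw
    exact fun h => hind x hx y hy ((hf x (hLW hx) y (hLW hy)).1 h)
  · intro v hv w hw hvw
    obtain ⟨x, hx, rfl⟩ := Finset.mem_map.1 (Finset.mem_coe.1 hv)
    obtain ⟨y, hy, rfl⟩ := Finset.mem_map.1 (Finset.mem_coe.1 hw)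
    have := hp hx hy (by simpa using hvw)
    rw [this]
  · intro v hv
    obtain ⟨x, hx, rfl⟩ := Finset.mem_map.1 hv
    have h := hpL x hx
    refine ⟨by simpa using h.1, by simpa using hf.isCandidateParent h.2⟩

variable [DecidableEq V]

/-- Exchanging twins gives an automorphism of `G[W]` that maps one transversal to another. -/
theorem IsTransversal.exists_perm {L L' : Finset V} (hL : IsTransversal G W L)
    (hL' : IsTransversal G W L') :
    ∃ f : V ≃ V, PreservesAdj G W f ∧ W.map f.toEmbedding = W ∧ L.map f.toEmbedding = L' := by
  choose! c hc hvc hcv using fun v (hv : v ∈ L) => hL.exists_twin hL' hv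
  choose! c' hc' hvc' hcv' using fun v (hv : v ∈ L') => hL'.exists_twin hL hv
  have hcc : ∀ v ∈ L, c' (c v) = v := fun v hv =>
    hL.antichain _ (hc' _ (hc v hv)) _ hv ((hcv' _ (hc v hv)).trans (hcv v hv))
  have hcc' : ∀ v ∈ L', c (c' v) = v := fun v hv =>
    hL'.antichain _ (hc _ (hc' v hv)) _ hv ((hcv _ (hc' v hv)).trans (hcv' v hv))
  -- On `L ∩ L'` both `c` and `c'` are the identity, because a twin within an antichain is the
  -- vertex itself. The order of the two tests is therefore harmless.
  let f : V → V := fun x => if x ∈ L then c x else if x ∈ L' then c' x else x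
  have fL : ∀ x ∈ L, f x = c x := fun x hx => if_pos hx
  have fL' : ∀ x ∉ L, x ∈ L' → f x = c' x := fun x hx hx' => by simp [f, hx, hx']
  have fid : ∀ x ∉ L, x ∉ L' → f x = x := fun x hx hx' => by simp [f, hx, hx']
  have hinv : Function.Involutive f := by
    intro x
    by_cases hx : x ∈ L
    · rw [fL x hx]
      by_cases hcx : c x ∈ L
      · have := hL.antichain _ hx _ hcx (hvc x hx)
        rw [← this, fL x hx, ← this]
      · rw [fL' _ hcx (hc x hx), hcc x hx]
    · by_cases hx' : x ∈ L'
      · rw [fL' x hx hx', fL _ (hc' x hx'), hcc' x hx']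
      · rw [fid x hx hx', fid x hx hx']
  have htwin : ∀ x ∈ W, NbhdLE G W x (f x) ∧ NbhdLE G W (f x) x := by
    intro x hxW
    by_cases hx : x ∈ L
    · rw [fL x hx]; exact ⟨hvc x hx, hcv x hx⟩
    · by_cases hx' : x ∈ L'
      · rw [fL' x hx hx']; exact ⟨hvc' x hx', hcv' x hx'⟩
      · rw [fid x hx hx']; exact ⟨.refl hxW, .refl hxW⟩
  -- The endpoints are replaced by their twins one at a time; injectivity of `f` excludes that the
  -- new endpoints coincide.
  have hadj : ∀ x ∈ W, ∀ y ∈ W, G.Adj x y → G.Adj (f x) (f y) := by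
    intro x hx y hy hxy
    have h1 := (htwin x hx).1.2.2 y hy (Or.inr hxy)
    have h2 := (htwin y hy).1.2.2 (f x) (htwin x hx).1.2.1
      (h1.imp Eq.symm fun h => h.symm)
    exact (h2.resolve_left fun h => hxy.ne (hinv.injective h)).symm
  refine ⟨hinv.toPerm, ?_, ?_, ?_⟩
  · intro x hx y hy
    refine ⟨fun h => ?_, hadj x hx y hy⟩
    have := hadj _ (htwin x hx).1.2.1 _ (htwin y hy).1.2.1 h
    rwa [hinv x, hinv y] at this
  · refine Finset.eq_of_subset_of_card_le ?_ (by simp)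
    intro y hy
    obtain ⟨x, hx, rfl⟩ := Finset.mem_map.1 hy
    exact (htwin x hx).1.2.1
  · ext y
    constructor
    · intro hy
      obtain ⟨x, hx, rfl⟩ := Finset.mem_map.1 hy
      change f x ∈ L'
      rw [fL x hx]; exact hc x hx
    · intro hy
      refine Finset.mem_map.2 ⟨c' y, hc' y hy, ?_⟩
      change f (c' y) = y
      rw [fL _ (hc' y hy), hcc' y hy]

/-- `p` injects `L` into `W \ L`, which has the same number of elements, so it is onto. -/
theorem IsValid.exists_child {L : Finset V} (hLW : L ⊆ W) (hcard : 2 * L.card = W.card)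
    {p : V → V} (hp : Set.InjOn p (L : Set V))
    (hpL : ∀ v ∈ L, p v ∉ L ∧ IsCandidateParent G W (p v) v) {x : V} (hx : x ∈ W)
    (hxL : x ∉ L) : ∃ v ∈ L, p v = x := by
  have : L.image p = W \ L := by
    apply Finset.eq_of_subset_of_card_le
    · intro y hy
      obtain ⟨v, hv, rfl⟩ := Finset.mem_image.1 hy
      exact Finset.mem_sdiff.2 ⟨(hpL v hv).2.1, (hpL v hv).1⟩
    · rw [Finset.card_image_of_injOn hp, Finset.card_sdiff_of_subset hLW]; omega
  have hx' : x ∈ L.image p := this ▸ Finset.mem_sdiff.2 ⟨hx, hxL⟩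
  simpa using hx'

/-- A vertex outside `L` is the parent of some vertex of `L`, which lies below it. Comparable
distinct vertices are adjacent, so independence gives the antichain property. -/
theorem IsValid.isTransversal {L : Finset V} (h : IsValid G W L) : IsTransversal G W L := by
  obtain ⟨hLW, hc, hcard, hind, p, hp, hpL⟩ := h
  refine ⟨hLW, fun x hx => ?_, fun v hv w hw hvw => ?_⟩
  · by_cases hxL : x ∈ L
    · exact ⟨x, hxL, .refl hx⟩
    · obtain ⟨v, hv, rfl⟩ := IsValid.exists_child hLW hcard hp hpL hx hxL
      exact ⟨v, hv, (hpL v hv).2.nbhdLE⟩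
  · exact hvw.eq_or_adj.resolve_right (hind w hw v hv)

/-- The automorphism that exchanges twins carries the valid set to the given transversal. This
allows one canonical transversal to be tested instead of searching for a valid set. -/
theorem IsTransversal.isValid {L L' : Finset V} (hL : IsTransversal G W L)
    (hL' : IsValid G W L') : IsValid G W L := by
  obtain ⟨f, hf, hW, hLL'⟩ := hL'.isTransversal.exists_perm hL
  have := hL'.map hf
  rwa [hW, hLL'] at this

end ValidSets

/-! ### Candidate matchings and their 2-SAT formulas -/

section Matchings

variable {V : Type} {G : SimpleGraph V} {W : Finset V} {m : ℕ} {M : Fin m → V × V}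
  {τ : Fin m → Bool}

theorem IsCandidateMatching.index_unique (hM : IsCandidateMatching G W M) {x : V} {i j : Fin m}
    (hi : x = (M i).1 ∨ x = (M i).2) (hj : x = (M j).1 ∨ x = (M j).2) : i = j := by
  have hx : x ∈ W := by
    rcases hi with rfl | rfl
    · exact (hM.1 i).1
    · exact (hM.1 i).2.1
  exact (hM.2 x hx).unique hi hj

theorem childOf_mem_pair (M : Fin m → V × V) (τ : Fin m → Bool) (i : Fin m) :
    childOf M τ i = (M i).1 ∨ childOf M τ i = (M i).2 := by
  unfold childOf; split <;> simp

theorem parentOf_mem_pair (M : Fin m → V × V) (τ : Fin m → Bool) (i : Fin m) :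
    parentOf M τ i = (M i).1 ∨ parentOf M τ i = (M i).2 := by
  unfold parentOf; split <;> simp

theorem IsCandidateMatching.childOf_injective (hM : IsCandidateMatching G W M) :
    Function.Injective (childOf M τ) := fun i j h =>
  hM.index_unique (childOf_mem_pair M τ i) (h ▸ childOf_mem_pair M τ j)

theorem IsCandidateMatching.parentOf_injective (hM : IsCandidateMatching G W M) :
    Function.Injective (parentOf M τ) := fun i j h =>
  hM.index_unique (parentOf_mem_pair M τ i) (h ▸ parentOf_mem_pair M τ j)

theorem IsCandidateMatching.parentOf_ne_childOf (hM : IsCandidateMatching G W M) (i j : Fin m) :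
    parentOf M τ i ≠ childOf M τ j := by
  intro h
  obtain rfl := hM.index_unique (parentOf_mem_pair M τ i) (h ▸ childOf_mem_pair M τ j)
  have := (hM.1 i).2.2.1.ne
  unfold parentOf childOf at h
  split at h
  · exact this h
  · exact this h.symm

theorem eq_parentOf_or_childOf {x : V} {i : Fin m} (h : x = (M i).1 ∨ x = (M i).2) :
    x = parentOf M τ i ∨ x = childOf M τ i := by
  unfold parentOf childOf; split <;> tauto

theorem IsCandidateMatching.childOf_mem (hM : IsCandidateMatching G W M) (i : Fin m) :
    childOf M τ i ∈ W := by
  unfold childOf; split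
  · exact (hM.1 i).2.1
  · exact (hM.1 i).1

theorem IsCandidateMatching.parentOf_mem (hM : IsCandidateMatching G W M) (i : Fin m) :
    parentOf M τ i ∈ W := by
  unfold parentOf; split
  · exact (hM.1 i).1
  · exact (hM.1 i).2.1

/-- If the inclusion held only in the opposite direction, a unit clause would force the opposite
value of the variable. -/
theorem IsCandidateMatching.parentOf_isCandidateParent (hM : IsCandidateMatching G W M)
    (hτ : Satisfies τ (formula G W M)) (i : Fin m) :
    IsCandidateParent G W (parentOf M τ i) (childOf M τ i) := by
  have h := (hM.1 i).2.2.2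
  by_cases hi : τ i = true
  · simp only [parentOf, childOf, hi, if_true]
    by_contra hn
    have := hτ ((i, false), (i, false)) (by
      simp only [formula, Set.mem_union, Set.mem_ofPred_eq]
      exact .inl (.inl (.inl (.inl ⟨i, rfl, h.resolve_left hn, hn⟩))))
    simp [hi] at this
  · simp only [parentOf, childOf, hi]
    by_contra hn
    have := hτ ((i, true), (i, true)) (by
      simp only [formula, Set.mem_union, Set.mem_ofPred_eq]
      exact .inl (.inl (.inl (.inr ⟨i, rfl, h.resolve_right hn, hn⟩))))
    simp [hi] at this

variable [DecidableEq V]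

theorem mem_chosen {x : V} : x ∈ chosen M τ ↔ ∃ i, childOf M τ i = x := by
  simp [chosen]

theorem IsCandidateMatching.parentOf_notMem_chosen (hM : IsCandidateMatching G W M) (i : Fin m) :
    parentOf M τ i ∉ chosen M τ := fun h => by
  obtain ⟨j, hj⟩ := mem_chosen.1 h
  exact hM.parentOf_ne_childOf i j hj.symm

theorem IsCandidateMatching.card_chosen (hM : IsCandidateMatching G W M) :
    (chosen M τ).card = m := by
  rw [chosen, Finset.card_image_of_injective _ hM.childOf_injective, Finset.card_fin]

theorem IsCandidateMatching.chosen_subset (hM : IsCandidateMatching G W M) :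
    chosen M τ ⊆ W := fun x hx => by
  obtain ⟨i, rfl⟩ := mem_chosen.1 hx
  exact hM.childOf_mem i

theorem IsCandidateMatching.card_eq (hM : IsCandidateMatching G W M) : W.card = 2 * m := by
  -- The constant assignment only serves to separate the two endpoints of every edge.
  have h : W = chosen M (fun _ => true) ∪ Finset.univ.image (parentOf M fun _ => true) := by
    ext x
    simp only [Finset.mem_union, mem_chosen, Finset.mem_image, Finset.mem_univ, true_and]
    constructor
    · intro hx
      obtain ⟨i, hi, -⟩ := hM.2 x hx
      rcases eq_parentOf_or_childOf (τ := fun _ => true) hi with h | h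
      · exact Or.inr ⟨i, h.symm⟩
      · exact Or.inl ⟨i, h.symm⟩
    · rintro (⟨i, rfl⟩ | ⟨i, rfl⟩)
      · exact hM.childOf_mem i
      · exact hM.parentOf_mem i
  rw [h, Finset.card_union_of_disjoint, hM.card_chosen,
    Finset.card_image_of_injective _ hM.parentOf_injective, Finset.card_fin, two_mul]
  rw [Finset.disjoint_left]
  intro x hx hx'
  obtain ⟨i, -, rfl⟩ := Finset.mem_image.1 hx'
  exact hM.parentOf_notMem_chosen i hx

/-- The unit clauses provide the parents, and the three families of two-literal clauses exclude the
three kinds of edges between chosen children. -/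
theorem IsCandidateMatching.isValid_chosen (hM : IsCandidateMatching G W M)
    (hτ : Satisfies τ (formula G W M)) : IsValid G W (chosen M τ) := by
  refine ⟨hM.chosen_subset, ?_, by rw [hM.card_chosen, hM.card_eq], ?_, ?_⟩
  · intro v hv
    obtain ⟨i, rfl⟩ := mem_chosen.1 hv
    exact ⟨_, hM.parentOf_isCandidateParent hτ i⟩
  · intro v hv w hw hvw
    obtain ⟨i, rfl⟩ := mem_chosen.1 hv
    obtain ⟨j, rfl⟩ := mem_chosen.1 hw
    have hij : i ≠ j := fun h => hvw.ne (by rw [h])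
    cases hi : τ i <;> cases hj : τ j <;> simp only [childOf, hi, hj] at hvw
    · have := hτ ((i, true), (j, true)) (by
        simp only [formula, Set.mem_union, Set.mem_ofPred_eq]
        exact .inl (.inl (.inr ⟨i, j, rfl, hvw⟩)))
      simp [hi, hj] at this
    · have := hτ ((i, true), (j, false)) (by
        simp only [formula, Set.mem_union, Set.mem_ofPred_eq]
        exact .inr ⟨i, j, rfl, hij, hvw⟩)
      simp [hi, hj] at this
    -- The clauses list the `u`-endpoint first, so the edge is read backwards here.
    · have := hτ ((j, true), (i, false)) (by
        simp only [formula, Set.mem_union, Set.mem_ofPred_eq]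
        exact .inr ⟨j, i, rfl, hij.symm, hvw.symm⟩)
      simp [hi, hj] at this
    · have := hτ ((i, false), (j, false)) (by
        simp only [formula, Set.mem_union, Set.mem_ofPred_eq]
        exact .inl (.inr ⟨i, j, rfl, hvw⟩))
      simp [hi, hj] at this
  · have hinj := hM.childOf_injective (τ := τ)
    -- Each child is sent to its partner through its index; the value outside the chosen set is
    -- irrelevant.
    refine ⟨fun v => if h : ∃ i, childOf M τ i = v then parentOf M τ h.choose else v, ?_, ?_⟩
    · intro v hv w hw hvw
      obtain ⟨i, rfl⟩ := mem_chosen.1 (Finset.mem_coe.1 hv)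
      obtain ⟨j, rfl⟩ := mem_chosen.1 (Finset.mem_coe.1 hw)
      have hi : ∃ i', childOf M τ i' = childOf M τ i := ⟨i, rfl⟩
      have hj : ∃ j', childOf M τ j' = childOf M τ j := ⟨j, rfl⟩
      simp only [dif_pos hi, dif_pos hj] at hvw
      rw [← hi.choose_spec, ← hj.choose_spec, hM.parentOf_injective hvw]
    · intro v hv
      have hi := mem_chosen.1 hv
      simp only [dif_pos hi]
      refine ⟨hM.parentOf_notMem_chosen _, ?_⟩
      have := hM.parentOf_isCandidateParent hτ hi.choose
      rwa [hi.choose_spec] at this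

/-- A valid set contains exactly one endpoint of every edge of a candidate matching. -/
theorem IsValid.mem_or_mem {L : Finset V} (hL : IsValid G W L) (hM : IsCandidateMatching G W M)
    (i : Fin m) : (M i).1 ∈ L ∨ (M i).2 ∈ L := by
  by_contra hn
  push Not at hn
  obtain ⟨hLW, -, hcard, hind, -⟩ := hL
  have : Nonempty (Fin m) := ⟨i⟩
  choose! g hg using fun x (hx : x ∈ L) => (hM.2 x (hLW hx)).exists
  have hmaps : ∀ x ∈ L, g x ∈ Finset.univ.erase i := by
    intro x hx
    refine Finset.mem_erase.2 ⟨?_, Finset.mem_univ _⟩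
    rintro rfl
    rcases hg x hx with h | h
    · exact hn.1 (h ▸ hx)
    · exact hn.2 (h ▸ hx)
  -- If edge `i` were missed, the `m` vertices of `L` would lie on `m - 1` edges. Two of them would
  -- share an edge and be adjacent.
  have hlt : (Finset.univ.erase i).card < L.card := by
    rw [Finset.card_erase_of_mem (Finset.mem_univ _), Finset.card_fin]
    have := hM.card_eq
    have := i.pos
    omega
  obtain ⟨x, hx, y, hy, hxy, hgxy⟩ := Finset.exists_ne_map_eq_of_card_lt_of_maps_to hlt hmaps
  have hadj := (hM.1 (g x)).2.2.1
  have h1 := hg x hx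
  have h2 := hg y hy
  rw [← hgxy] at h2
  rcases h1 with h1 | h1 <;> rcases h2 with h2 | h2
  · exact hxy (h1.trans h2.symm)
  · rw [← h1, ← h2] at hadj
    exact hind x hx y hy hadj
  · rw [← h1, ← h2] at hadj
    exact hind y hy x hx hadj
  · exact hxy (h1.trans h2.symm)

/-- Each variable records which endpoint of its edge lies in `L`. A violated two-literal clause
would be an edge inside `L`; for the unit clauses, minimality of the endpoint in `L` turns an
inclusion below it into an equality of closed neighbourhoods. -/
theorem IsValid.exists_satisfies {L : Finset V} (hL : IsValid G W L)
    (hM : IsCandidateMatching G W M) : ∃ τ : Fin m → Bool, Satisfies τ (formula G W M) := by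
  have hind := hL.2.2.2.1
  have hT := hL.isTransversal
  refine ⟨fun i => decide ((M i).2 ∈ L), ?_⟩
  rintro c ((((⟨i, rfl, h1, h2⟩ | ⟨i, rfl, h1, h2⟩) | ⟨i, j, rfl, h⟩) | ⟨i, j, rfl, h⟩) |
    ⟨i, j, rfl, hij, h⟩)
  · simp only [or_self, decide_eq_false_iff_not]
    intro hv
    exact h2 (isCandidateParent_iff.2 ⟨h1.2.2.1.symm, hT.ge_of_le hv h1.nbhdLE⟩)
  · simp only [or_self, decide_eq_true_eq]
    by_contra hv
    have hu := (hL.mem_or_mem hM i).resolve_right hv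
    exact h2 (isCandidateParent_iff.2 ⟨h1.2.2.1.symm, hT.ge_of_le hu h1.nbhdLE⟩)
  · simp only [decide_eq_true_eq]
    by_contra! hn
    exact hind _ ((hL.mem_or_mem hM i).resolve_right hn.1) _
      ((hL.mem_or_mem hM j).resolve_right hn.2) h
  · simp only [decide_eq_false_iff_not]
    by_contra! hn
    exact hind _ hn.1 _ hn.2 h
  · simp only [decide_eq_true_eq, decide_eq_false_iff_not]
    by_contra! hn
    exact hind _ ((hL.mem_or_mem hM i).resolve_right hn.1) _ hn.2 h

/-- The matching between a set and its candidate parents, listed along an enumeration. -/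
theorem isCandidateMatching_of_parents {L : Finset V} (hLW : L ⊆ W) (hcard : 2 * L.card = W.card)
    {p : V → V} (hp : Set.InjOn p (L : Set V))
    (hpL : ∀ v ∈ L, p v ∉ L ∧ IsCandidateParent G W (p v) v) :
    IsCandidateMatching G W fun i : Fin L.card =>
      (p (L.equivFin.symm i), (L.equivFin.symm i : V)) := by
  refine ⟨fun i => ?_, fun x hx => ?_⟩
  · have h := (hpL _ (L.equivFin.symm i).2).2
    exact ⟨h.1, h.2.1, h.adj, Or.inl h⟩
  · have key : ∀ i : Fin L.card, ∀ v ∈ L, (L.equivFin.symm i : V) = v →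
        ∀ hv : v ∈ L, i = L.equivFin ⟨v, hv⟩ := by
      intro i v _ h hv
      rw [← L.equivFin.symm_apply_eq.1 (Subtype.ext h : L.equivFin.symm i = ⟨v, hv⟩)]
    by_cases hxL : x ∈ L
    · refine ⟨L.equivFin ⟨x, hxL⟩, by simp, ?_⟩
      rintro j (h | h)
      · have h : x = p (L.equivFin.symm j) := h
        exact absurd (h ▸ hxL) (hpL _ (L.equivFin.symm j).2).1
      · exact key j x hxL h.symm hxL
    · obtain ⟨v, hv, rfl⟩ := IsValid.exists_child hLW hcard hp hpL hx hxL
      refine ⟨L.equivFin ⟨v, hv⟩, by simp, ?_⟩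
      rintro j (h | h)
      · exact key j v hv (hp (L.equivFin.symm j).2 hv h.symm) hv
      · have h : p v = L.equivFin.symm j := h
        exact absurd (h ▸ (L.equivFin.symm j).2) hxL

theorem IsValid.exists_isCandidateMatching {L : Finset V} (hL : IsValid G W L) :
    ∃ (m : ℕ) (M : Fin m → V × V), IsCandidateMatching G W M := by
  obtain ⟨hLW, -, hcard, -, p, hp, hpL⟩ := hL
  exact ⟨_, _, isCandidateMatching_of_parents hLW hcard hp hpL⟩

end Matchings

/-! ### Growth schedules without excess edges -/

section Schedules

variable {V : Type} {G : SimpleGraph V} {W : Finset V}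

/-- `K` is the subgraph of `G` induced by `W`. -/
def GraphInstance.IsInduced (K : GraphInstance V) (G : SimpleGraph V) (W : Finset V) : Prop :=
  K.verts = W ∧ ∀ a b, s(a, b) ∈ K.edges ↔ G.Adj a b ∧ a ∈ W ∧ b ∈ W

variable [DecidableEq V]

/-- `GrowsFrom` unfolds at the first slot, but the algorithm and the counting argument both peel off
the last one. -/
theorem growsFrom_append_singleton {H K : GraphInstance V} {l : List (Slot V)} {S : Slot V} :
    GrowsFrom H (l ++ [S]) K ↔ ∃ K', GrowsFrom H l K' ∧ S.Admissible K' ∧ K = K'.next S := by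
  induction l generalizing H with
  | nil => simp [GrowsFrom]
  | cons T l ih =>
    simp only [List.cons_append, GrowsFrom, ih]
    constructor
    · rintro ⟨h, K', h', h''⟩; exact ⟨K', ⟨h, h'⟩, h''⟩
    · rintro ⟨K', ⟨h, h'⟩, h''⟩; exact ⟨h, K', h', h''⟩

theorem Slot.mem_generated {S : Slot V} {v : V} :
    v ∈ S.generated ↔ ∃ u A, (u, v, A) ∈ S.births := by
  simp [Slot.generated]

theorem Slot.mem_activated {S : Slot V} {e : Sym2 V} :
    e ∈ S.activated ↔ ∃ u v A, (u, v, A) ∈ S.births ∧ ∃ w ∈ A, s(v, w) = e := by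
  simp [Slot.activated]

theorem mem_matchingSlot_births {m : ℕ} {M : Fin m → V × V} {τ : Fin m → Bool} {u v : V}
    {A : Finset V} : (u, v, A) ∈ (matchingSlot G W M τ).births ↔
      ∃ i, parentOf M τ i = u ∧ childOf M τ i = v ∧ ∀ w, w ∈ A ↔ w ∈ W ∧ G.Adj v w := by
  simp only [matchingSlot, Finset.mem_image, Finset.mem_univ, true_and, Prod.mk.injEq]
  refine exists_congr fun i => and_congr_right fun _ => and_congr_right fun h => ?_
  subst h
  simp only [Finset.ext_iff, Finset.mem_filter]
  exact forall_congr' fun w => Iff.comm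

/-- Independence places all neighbours of a child among the older vertices, and the inclusion of
closed neighbourhoods places them within distance one of the parent. -/
theorem IsCandidateMatching.admissible_matchingSlot {m : ℕ} {M : Fin m → V × V}
    {τ : Fin m → Bool} (hM : IsCandidateMatching G W M) (hτ : Satisfies τ (formula G W M))
    {K : GraphInstance V} (hK : K.IsInduced G (W \ chosen M τ)) :
    (matchingSlot G W M τ).Admissible K := by
  obtain ⟨hKv, hKe⟩ := hK
  have hind := (hM.isValid_chosen hτ).2.2.2.1
  have hpm : ∀ i, parentOf M τ i ∈ W \ chosen M τ := fun i =>
    Finset.mem_sdiff.2 ⟨hM.parentOf_mem i, hM.parentOf_notMem_chosen i⟩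
  refine ⟨?_, ?_, ?_, ?_, ?_, ?_, ?_⟩
  · intro u v A h
    obtain ⟨i, rfl, rfl, -⟩ := mem_matchingSlot_births.1 h
    rw [hKv]
    refine ⟨hpm i, fun h => ?_⟩
    exact (Finset.mem_sdiff.1 h).2 (mem_chosen.2 ⟨i, rfl⟩)
  · rintro ⟨u, v, A⟩ h ⟨u', v', A'⟩ h' rfl
    obtain ⟨i, hi, rfl, hA⟩ := mem_matchingSlot_births.1 h
    obtain ⟨j, hj, rfl, hA'⟩ := mem_matchingSlot_births.1 h'
    obtain rfl := hM.parentOf_injective (hi.trans hj.symm)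
    simp only [Prod.mk.injEq, true_and]
    ext w; rw [hA, hA']
  · rintro ⟨u, v, A⟩ h ⟨u', v', A'⟩ h' hv
    obtain rfl : v = v' := hv
    obtain ⟨i, rfl, hi, hA⟩ := mem_matchingSlot_births.1 h
    obtain ⟨j, rfl, hj, hA'⟩ := mem_matchingSlot_births.1 h'
    obtain rfl := hM.childOf_injective (hi.trans hj.symm)
    simp only [Prod.mk.injEq, true_and]
    ext w; rw [hA, hA']
  · intro u v A h
    obtain ⟨i, rfl, rfl, hA⟩ := mem_matchingSlot_births.1 h
    rw [hA]
    exact ⟨hM.parentOf_mem i, (hM.parentOf_isCandidateParent hτ i).adj.symm⟩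
  · intro u v A h w hw
    obtain ⟨i, rfl, rfl, hA⟩ := mem_matchingSlot_births.1 h
    obtain ⟨hwW, hvw⟩ := (hA w).1 hw
    have hwL : w ∈ W \ chosen M τ := Finset.mem_sdiff.2 ⟨hwW, fun h =>
      hind _ (mem_chosen.2 ⟨i, rfl⟩) w h hvw⟩
    rw [hKv, hKe]
    refine ⟨hwL, ?_⟩
    rcases (hM.parentOf_isCandidateParent hτ i).2.2.2 w hwW (Or.inr hvw) with h | h
    · exact Or.inl h
    · exact Or.inr ⟨h, hpm i, hwL⟩
  · simp [matchingSlot]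
  · simp [matchingSlot, GraphInstance.next, GraphInstance.beforeDeletion, Slot.generated,
      Slot.activated]

/-- An edge of `G[W]` with a chosen endpoint is activated when that endpoint is born; all others are
already in `K`. -/
theorem IsCandidateMatching.isInduced_next {m : ℕ} {M : Fin m → V × V}
    {τ : Fin m → Bool} (hM : IsCandidateMatching G W M) (hτ : Satisfies τ (formula G W M))
    {K : GraphInstance V} (hK : K.IsInduced G (W \ chosen M τ)) :
    (K.next (matchingSlot G W M τ)).IsInduced G W := by
  obtain ⟨hKv, hKe⟩ := hK
  have hind := (hM.isValid_chosen hτ).2.2.2.1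
  have hgen : (matchingSlot G W M τ).generated = chosen M τ := by
    ext v
    rw [Slot.mem_generated, mem_chosen]
    constructor
    · rintro ⟨u, A, h⟩
      obtain ⟨i, -, hi, -⟩ := mem_matchingSlot_births.1 h
      exact ⟨i, hi⟩
    · rintro ⟨i, rfl⟩
      classical
      exact ⟨_, W.filter fun w => G.Adj (childOf M τ i) w,
        mem_matchingSlot_births.2 ⟨i, rfl, rfl, by simp⟩⟩
  have hact : ∀ v ∈ chosen M τ, ∀ w ∈ W, G.Adj v w →
      s(v, w) ∈ (matchingSlot G W M τ).activated := by
    intro v hv w hw hvw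
    obtain ⟨i, rfl⟩ := mem_chosen.1 hv
    classical
    exact Slot.mem_activated.2 ⟨_, _, W.filter fun w => G.Adj (childOf M τ i) w,
      mem_matchingSlot_births.2 ⟨i, rfl, rfl, by simp⟩, w, by simp [hw, hvw], rfl⟩
  refine ⟨?_, fun a b => ?_⟩
  · change K.verts ∪ _ = W
    rw [hKv, hgen, Finset.sdiff_union_of_subset hM.chosen_subset]
  · change s(a, b) ∈ (K.edges ∪ (matchingSlot G W M τ).activated) \ ∅ ↔ _
    rw [Finset.sdiff_empty, Finset.mem_union, hKe]
    constructor
    · rintro (⟨h, ha, hb⟩ | h)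
      · exact ⟨h, Finset.sdiff_subset ha, Finset.sdiff_subset hb⟩
      · obtain ⟨u, v, A, hb, w, hw, he⟩ := Slot.mem_activated.1 h
        obtain ⟨i, rfl, rfl, hA⟩ := mem_matchingSlot_births.1 hb
        obtain ⟨hwW, hvw⟩ := (hA w).1 hw
        rcases Sym2.eq_iff.1 he with ⟨rfl, rfl⟩ | ⟨rfl, rfl⟩
        · exact ⟨hvw, hM.childOf_mem i, hwW⟩
        · exact ⟨hvw.symm, hwW, hM.childOf_mem i⟩
    · rintro ⟨h, ha, hb⟩
      by_cases haL : a ∈ chosen M τ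
      · exact Or.inr (hact a haL b hb h)
      · by_cases hbL : b ∈ chosen M τ
        · exact Or.inr (Sym2.eq_swap ▸ hact b hbL a ha h.symm)
        · exact Or.inl ⟨h, Finset.mem_sdiff.2 ⟨ha, haL⟩, Finset.mem_sdiff.2 ⟨hb, hbL⟩⟩

/-- Soundness, by induction on the run: the slots before the current one build the graph without the
chosen set, and the current slot restores that set. -/
theorem FastGrowth.growsFrom {k : ℕ} {out : Option (Schedule V)} (h : FastGrowth G k W out) :
    ∀ σ ∈ out, (∃ K, GrowsFrom ⟨{σ.initiator}, ∅⟩ σ.slots K ∧ K.IsInduced G W) ∧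
      σ.slots.length = k ∧ σ.excess = 0 := by
  induction h with
  | done u =>
    rintro σ ⟨rfl⟩
    refine ⟨⟨_, rfl, rfl, fun a b => ?_⟩, rfl, rfl⟩
    simp only [Finset.notMem_empty, Finset.mem_singleton, false_iff]
    rintro ⟨h, rfl, rfl⟩
    exact h.ne rfl
  | noMatching => simp
  | unsatisfiable => simp
  | step k W m M τ out hM hτ hrest ih =>
    intro σ hσ
    obtain ⟨σ', hσ', rfl⟩ := Option.map_eq_some_iff.1 hσ
    obtain ⟨⟨K, hK, hKi⟩, hlen, hex⟩ := ih σ' hσ'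
    refine ⟨⟨K.next (matchingSlot G W M τ), growsFrom_append_singleton.2
      ⟨K, hK, hM.admissible_matchingSlot hτ hKi, rfl⟩, hM.isInduced_next hτ hKi⟩, ?_, ?_⟩
    · simp [hlen]
    · simpa [Schedule.excess, matchingSlot] using hex

/-! ### Dismantling by valid sets, and correctness of the answer "no" -/

/-- `G[W]` can be reduced to a single vertex by removing a valid set `k` times. -/
def Dismantles (G : SimpleGraph V) : ℕ → Finset V → Prop
  | 0, W => W.card = 1
  | k + 1, W => ∃ L, IsValid G W L ∧ Dismantles G k (W \ L)

theorem Dismantles.map {f : V ≃ V} {k : ℕ} (hf : PreservesAdj G W f) (h : Dismantles G k W) :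
    Dismantles G k (W.map f.toEmbedding) := by
  induction k generalizing W with
  | zero => simpa [Dismantles] using h
  | succ k ih =>
    obtain ⟨L, hL, h⟩ := h
    refine ⟨L.map f.toEmbedding, hL.map hf, ?_⟩
    rw [← Finset.map_sdiff]
    exact ih (hf.mono Finset.sdiff_subset) h

/-- The choice of valid set does not matter: the automorphism exchanging two valid sets also
exchanges their complements. -/
theorem Dismantles.sdiff {k : ℕ} (h : Dismantles G (k + 1) W) {L : Finset V}
    (hL : IsValid G W L) : Dismantles G k (W \ L) := by
  obtain ⟨L', hL', h⟩ := h
  obtain ⟨f, hf, hW, hLL⟩ := hL'.isTransversal.exists_perm hL.isTransversal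
  have := h.map (hf.mono Finset.sdiff_subset)
  rwa [Finset.map_sdiff, hW, hLL] at this

/-- A valid set would provide both a matching and a satisfying assignment. In a recursive step, the
set actually removed is as good as any other valid set. -/
theorem FastGrowth.not_dismantles {k : ℕ} {out : Option (Schedule V)}
    (h : FastGrowth G k W out) (hout : out = none) : ¬ Dismantles G k W := by
  induction h with
  | done u => simp at hout
  | noMatching k W h =>
    rintro ⟨L, hL, -⟩
    exact h hL.exists_isCandidateMatching
  | unsatisfiable k W m M hM h =>
    rintro ⟨L, hL, -⟩
    exact h (hL.exists_satisfies hM)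
  | step k W m M τ out hM hτ hrest ih =>
    exact fun h => ih (by simpa using hout) (h.sdiff (hM.isValid_chosen hτ))

theorem Slot.Admissible.card_generated_le {S : Slot V} {K : GraphInstance V}
    (hS : S.Admissible K) : S.generated.card ≤ K.verts.card := by
  refine Finset.card_image_le.trans (Finset.card_le_card_of_injOn Prod.fst ?_ ?_)
  · rintro ⟨u, v, A⟩ h
    exact (hS.parent_mem u v A h).1
  · exact fun b hb b' hb' h => hS.parent_unique b hb b' hb' h

theorem Slot.Admissible.disjoint_generated {S : Slot V} {K : GraphInstance V}
    (hS : S.Admissible K) : Disjoint K.verts S.generated := by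
  rw [Finset.disjoint_right]
  intro v hv
  obtain ⟨u, A, h⟩ := Slot.mem_generated.1 hv
  exact (hS.parent_mem u v A h).2

theorem GrowsFrom.card_verts_le {u : V} {l : List (Slot V)} {K : GraphInstance V}
    (h : GrowsFrom ⟨{u}, ∅⟩ l K) : K.verts.card ≤ 2 ^ l.length := by
  induction l using List.reverseRecOn generalizing K with
  | nil => obtain rfl : K = _ := h; simp
  | append_singleton l S ih =>
    obtain ⟨K', hK', hS, rfl⟩ := growsFrom_append_singleton.1 h
    have := ih hK'
    have h1 := Finset.card_union_le K'.verts S.generated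
    have h2 := hS.card_generated_le
    simp only [GraphInstance.next, List.length_append, List.length_singleton, pow_succ]
    omega

/-- A `GraphInstance` does not force its edges to join its vertices; the rules of the process
preserve this property. -/
theorem GrowsFrom.mem_verts {u : V} {l : List (Slot V)} {K : GraphInstance V}
    (h : GrowsFrom ⟨{u}, ∅⟩ l K) {e : Sym2 V} (he : e ∈ K.edges) : ∀ a ∈ e, a ∈ K.verts := by
  induction l using List.reverseRecOn generalizing K with
  | nil => obtain rfl : K = _ := h; simp at he
  | append_singleton l S ih =>
    obtain ⟨K', hK', hS, rfl⟩ := growsFrom_append_singleton.1 h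
    intro a ha
    have he' := (Finset.mem_sdiff.1 he).1
    rcases Finset.mem_union.1 he' with he' | he'
    · exact Finset.mem_union_left _ (ih hK' he' a ha)
    · obtain ⟨u, v, A, hb, w, hw, rfl⟩ := Slot.mem_activated.1 he'
      rcases Sym2.mem_iff.1 ha with rfl | rfl
      · exact Finset.mem_union_right _ (Slot.mem_generated.2 ⟨u, A, hb⟩)
      · exact Finset.mem_union_left _ (hS.activation _ _ _ hb _ hw).1

/-- The vertices born in a slot without deletions that doubles the number of vertices form a valid
set of the resulting graph. -/
theorem Slot.Admissible.isValid_generated {S : Slot V} {K : GraphInstance V}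
    (hS : S.Admissible K) (hdel : S.deleted = ∅) (hcard : S.generated.card = K.verts.card)
    (hmem : ∀ e ∈ K.edges, ∀ a ∈ e, a ∈ K.verts) (hG : (K.next S).IsInduced G W) :
    IsValid G W S.generated := by
  obtain ⟨hW, hE⟩ := hG
  have hdisj := hS.disjoint_generated
  have hedge : ∀ a b, s(a, b) ∈ (K.next S).edges ↔ s(a, b) ∈ K.edges ∨ s(a, b) ∈ S.activated := by
    intro a b; simp [GraphInstance.next, hdel]
  replace hW : K.verts ∪ S.generated = W := hW
  have hKW : K.verts ⊆ W := hW ▸ Finset.subset_union_left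
  have hgW : S.generated ⊆ W := hW ▸ Finset.subset_union_right
  -- A neighbour of a new vertex is one of the endpoints activated for it.
  have hnbr : ∀ u v A, (u, v, A) ∈ S.births → ∀ x ∈ W, G.Adj v x → x ∈ A := by
    intro u v A hb x hx hvx
    have hvg : v ∈ S.generated := Slot.mem_generated.2 ⟨u, A, hb⟩
    rcases (hedge v x).1 ((hE v x).2 ⟨hvx, hgW hvg, hx⟩) with h | h
    · exact absurd hvg (Finset.disjoint_left.1 hdisj (hmem _ h v (Sym2.mem_mk_left _ _)))
    -- The activating birth must be that of `v` itself: in the other orientation `v` would be an old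
    -- vertex.
    · obtain ⟨u', v', A', hb', w, hw, he⟩ := Slot.mem_activated.1 h
      rcases Sym2.eq_iff.1 he with ⟨rfl, rfl⟩ | ⟨rfl, rfl⟩
      · have := hS.child_unique _ hb _ hb' rfl
        simp only [Prod.mk.injEq, true_and] at this
        exact this.2 ▸ hw
      · exact absurd hvg (Finset.disjoint_left.1 hdisj (hS.activation _ _ _ hb' _ hw).1)
  -- All neighbours of a newborn vertex were activated at its birth, hence lie in the closed
  -- neighbourhood of its parent.
  have hpar : ∀ u v A, (u, v, A) ∈ S.births → IsCandidateParent G W u v := by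
    intro u v A hb
    have hvg : v ∈ S.generated := Slot.mem_generated.2 ⟨u, A, hb⟩
    obtain ⟨hu, hv⟩ := hS.parent_mem u v A hb
    have hact : ∀ w ∈ A, G.Adj v w := fun w hw =>
      ((hE v w).1 ((hedge v w).2 (Or.inr (Slot.mem_activated.2 ⟨u, v, A, hb, w, hw, rfl⟩)))).1
    refine ⟨hKW hu, hgW hvg, fun h => hv (h ▸ hu), fun x hx hvx => ?_⟩
    rcases hvx with rfl | hvx
    · exact Or.inr (hact u (hS.parent_edge u x A hb)).symm
    · rcases (hS.activation u v A hb x (hnbr u v A hb x hx hvx)).2 with h | h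
      · exact Or.inl h
      · exact Or.inr ((hE u x).1 ((hedge u x).2 (Or.inl h))).1
  choose! p A hp using fun v (hv : v ∈ S.generated) => Slot.mem_generated.1 hv
  refine ⟨hgW, fun v hv => ⟨p v, hpar _ _ _ (hp v hv)⟩, ?_, ?_, p, ?_, fun v hv => ⟨?_, ?_⟩⟩
  · rw [← hW, Finset.card_union_of_disjoint hdisj]; omega
  · intro v hv w hw hvw
    have := hnbr _ _ _ (hp v hv) w (hgW hw) hvw
    exact Finset.disjoint_left.1 hdisj (hS.activation _ _ _ (hp v hv) w this).1 hw
  · intro v hv w hw hvw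
    have := hS.parent_unique _ (hp v hv) _ (hp w hw) hvw
    simp only [Prod.mk.injEq] at this
    exact this.2.1
  · exact Finset.disjoint_left.1 hdisj (hS.parent_mem _ _ _ (hp v hv)).1
  · exact hpar _ _ _ (hp v hv)

/-- Since each slot at most doubles the number of vertices, reaching `2 ^ l.length` leaves no slack,
and the newborns of the last slot form a valid set. -/
theorem GrowsFrom.dismantles {u : V} {l : List (Slot V)} {K : GraphInstance V}
    (h : GrowsFrom ⟨{u}, ∅⟩ l K) (hdel : ∀ S ∈ l, S.deleted = ∅)
    (hcard : W.card = 2 ^ l.length) (hK : K.IsInduced G W) : Dismantles G l.length W := by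
  induction l using List.reverseRecOn generalizing K W with
  | nil => simpa [Dismantles] using hcard
  | append_singleton l S ih =>
    obtain ⟨K', hK', hS, rfl⟩ := growsFrom_append_singleton.1 h
    have hdisj := hS.disjoint_generated
    have h1 := hK'.card_verts_le
    have h2 := hS.card_generated_le
    have hW : K'.verts ∪ S.generated = W := hK.1
    have hSdel : S.deleted = ∅ := hdel S (by simp)
    rw [← hW, Finset.card_union_of_disjoint hdisj, List.length_append, List.length_singleton,
      pow_succ] at hcard
    have hval := hS.isValid_generated hSdel (by omega) (fun e he => hK'.mem_verts he) hK
    have hsub : W \ S.generated = K'.verts := by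
      rw [← hW, Finset.union_sdiff_right, Finset.sdiff_eq_self_of_disjoint hdisj]
    rw [List.length_append, List.length_singleton]
    refine ⟨_, hval, ih hK' (fun T hT => hdel T (by simp [hT])) (by rw [hsub]; omega) ?_⟩
    refine ⟨hsub.symm, fun a b => ?_⟩
    rw [hsub]
    have hab := hK.2 a b
    have hedge : s(a, b) ∈ (K'.next S).edges ↔ s(a, b) ∈ K'.edges ∨ s(a, b) ∈ S.activated := by
      simp [GraphInstance.next, hSdel]
    constructor
    · intro h
      exact ⟨(hab.1 (hedge.2 (Or.inl h))).1, hK'.mem_verts h a (Sym2.mem_mk_left _ _),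
        hK'.mem_verts h b (Sym2.mem_mk_right _ _)⟩
    · rintro ⟨h, ha, hb⟩
      have hKW : K'.verts ⊆ W := hW ▸ Finset.subset_union_left
      refine (hedge.1 (hab.2 ⟨h, hKW ha, hKW hb⟩)).resolve_right fun h => ?_
      obtain ⟨u, v, A, hbirth, w, -, he⟩ := Slot.mem_activated.1 h
      have hv := (hS.parent_mem u v A hbirth).2
      rcases Sym2.eq_iff.1 he with ⟨rfl, rfl⟩ | ⟨rfl, rfl⟩
      · exact hv ha
      · exact hv hb

/-- Every answer of the fast growth algorithm is correct. -/
theorem FastGrowth.isCorrectAnswer [Fintype V] {k : ℕ} (hV : Fintype.card V = 2 ^ k)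
    {out : Option (Schedule V)} (h : FastGrowth G k Finset.univ out) :
    IsCorrectAnswer G k out := by
  cases out with
  | some σ =>
    obtain ⟨⟨K, hK, hKv, hKe⟩, hlen, hex⟩ := h.growsFrom σ rfl
    refine ⟨⟨K, hK, hKv, ?_⟩, hlen, hex⟩
    ext ⟨a, b⟩
    simpa using hKe a b
  | none =>
    rintro ⟨σ, ⟨K, hK, hKv, hKe⟩, rfl, hex⟩
    refine h.not_dismantles rfl (hK.dismantles ?_ (by simpa using hV) ⟨hKv, fun a b => ?_⟩)
    -- A vanishing sum of deletion counts makes every slot free of deletions.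
    · intro S hS
      have := List.sum_eq_zero_iff.1 hex _ (List.mem_map.2 ⟨S, hS, rfl⟩)
      exact Finset.card_eq_zero.1 this
    · rw [← Finset.mem_coe, hKe]; simp

end Schedules

/-! ### Loop programs: programs whose loops run over `0, …, n-1`, where `n` is in register `0` -/

namespace Expr

/-- The registers read by an expression. -/
def regs : Expr → List ℕ
  | const _ => []
  | reg i => [i]
  | get _ e₁ e₂ => e₁.regs ++ e₂.regs
  | add e₁ e₂ => e₁.regs ++ e₂.regs
  | sub e₁ e₂ => e₁.regs ++ e₂.regs

/-- The arrays read by an expression. -/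
def arrs : Expr → List ℕ
  | const _ => []
  | reg _ => []
  | get a e₁ e₂ => a :: (e₁.arrs ++ e₂.arrs)
  | add e₁ e₂ => e₁.arrs ++ e₂.arrs
  | sub e₁ e₂ => e₁.arrs ++ e₂.arrs

/-- A test expression succeeds when its value is nonzero. -/
def Holds (s : Memory) (e : Expr) : Prop := e.eval s ≠ 0

theorem eval_congr {s s' : Memory} {e : Expr} (hr : ∀ i ∈ e.regs, s'.reg i = s.reg i)
    (ha : ∀ a ∈ e.arrs, s'.arr a = s.arr a) : e.eval s' = e.eval s := by
  induction e with
  | const c => rfl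
  | reg i => exact hr i (by simp [regs])
  | get a e₁ e₂ ih₁ ih₂ =>
    simp only [regs, arrs, List.mem_append, List.mem_cons] at hr ha
    simp only [eval, ih₁ (fun i h => hr i (.inl h)) (fun i h => ha i (.inr (.inl h))),
      ih₂ (fun i h => hr i (.inr h)) (fun i h => ha i (.inr (.inr h))), ha a (.inl rfl)]
  | add e₁ e₂ ih₁ ih₂ =>
    simp only [regs, arrs, List.mem_append] at hr ha
    simp only [eval, ih₁ (fun i h => hr i (.inl h)) (fun i h => ha i (.inl h)),
      ih₂ (fun i h => hr i (.inr h)) (fun i h => ha i (.inr h))]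
  | sub e₁ e₂ ih₁ ih₂ =>
    simp only [regs, arrs, List.mem_append] at hr ha
    simp only [eval, ih₁ (fun i h => hr i (.inl h)) (fun i h => ha i (.inl h)),
      ih₂ (fun i h => hr i (.inr h)) (fun i h => ha i (.inr h))]

def not (e : Expr) : Expr := sub (const 1) e
def or (e₁ e₂ : Expr) : Expr := add e₁ e₂
def and (e₁ e₂ : Expr) : Expr := not (add (not e₁) (not e₂))
def imp (e₁ e₂ : Expr) : Expr := or (not e₁) e₂
def lt (e₁ e₂ : Expr) : Expr := sub e₂ e₁
def le (e₁ e₂ : Expr) : Expr := not (sub e₁ e₂)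
def eq (e₁ e₂ : Expr) : Expr := and (le e₁ e₂) (le e₂ e₁)

variable {s : Memory} {e₁ e₂ : Expr}

@[simp] theorem holds_reg {i : ℕ} : Holds s (reg i) ↔ s.reg i ≠ 0 := Iff.rfl

@[simp] theorem holds_get {a : ℕ} :
    Holds s (get a e₁ e₂) ↔ s.arr a (e₁.eval s) (e₂.eval s) ≠ 0 := Iff.rfl

@[simp] theorem holds_const {c : ℕ} : Holds s (const c) ↔ c ≠ 0 := Iff.rfl

@[simp] theorem holds_not : Holds s (not e₁) ↔ ¬ Holds s e₁ := by
  simp only [Holds, not, eval]; omega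

@[simp] theorem holds_or : Holds s (or e₁ e₂) ↔ Holds s e₁ ∨ Holds s e₂ := by
  simp only [Holds, or, eval]; omega

@[simp] theorem holds_and : Holds s (and e₁ e₂) ↔ Holds s e₁ ∧ Holds s e₂ := by
  simp only [Holds, and, not, eval]; omega

@[simp] theorem holds_imp : Holds s (imp e₁ e₂) ↔ (Holds s e₁ → Holds s e₂) := by
  rw [imp, holds_or, holds_not]; tauto

@[simp] theorem holds_lt : Holds s (lt e₁ e₂) ↔ e₁.eval s < e₂.eval s := by
  simp only [Holds, lt, eval]; omega

@[simp] theorem holds_le : Holds s (le e₁ e₂) ↔ e₁.eval s ≤ e₂.eval s := by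
  simp only [Holds, le, not, eval]; omega

@[simp] theorem holds_eq : Holds s (eq e₁ e₂) ↔ e₁.eval s = e₂.eval s := by
  rw [eq, holds_and, holds_le, holds_le, le_antisymm_iff]

instance (s : Memory) (e : Expr) : Decidable (Holds s e) := inferInstanceAs (Decidable (_ ≠ _))

end Expr

theorem Memory.reg_writeReg (s : Memory) (i x j : ℕ) :
    (s.writeReg i x).reg j = if j = i then x else s.reg j := by
  simp [Memory.writeReg, Function.update_apply]

theorem Memory.arr_writeReg (s : Memory) (i x : ℕ) : (s.writeReg i x).arr = s.arr := rfl

theorem Memory.reg_writeArr (s : Memory) (a i j x : ℕ) : (s.writeArr a i j x).reg = s.reg := rfl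

theorem Memory.arr_writeArr (s : Memory) (a i j x a' i' j' : ℕ) :
    (s.writeArr a i j x).arr a' i' j' =
      if a' = a ∧ i' = i ∧ j' = j then x else s.arr a' i' j' := rfl

/-- The memories agree except on the registers in `R` and the arrays in `A`. -/
def Memory.AgreeOff (R A : List ℕ) (s s' : Memory) : Prop :=
  (∀ i ∉ R, s'.reg i = s.reg i) ∧ ∀ a ∉ A, s'.arr a = s.arr a

theorem Memory.AgreeOff.refl {R A : List ℕ} (s : Memory) : s.AgreeOff R A s :=
  ⟨fun _ _ => rfl, fun _ _ => rfl⟩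

theorem Memory.AgreeOff.trans {R A : List ℕ} {s s' s'' : Memory} (h : s.AgreeOff R A s')
    (h' : s'.AgreeOff R A s'') : s.AgreeOff R A s'' :=
  ⟨fun i hi => (h'.1 i hi).trans (h.1 i hi), fun a ha => (h'.2 a ha).trans (h.2 a ha)⟩

theorem Memory.AgreeOff.mono {R A R' A' : List ℕ} {s s' : Memory} (h : s.AgreeOff R A s')
    (hR : R ⊆ R') (hA : A ⊆ A') : s.AgreeOff R' A' s' :=
  ⟨fun i hi => h.1 i fun h' => hi (hR h'), fun a ha => h.2 a fun h' => ha (hA h')⟩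

theorem Memory.AgreeOff.writeReg {R A : List ℕ} {s s' : Memory} (h : s.AgreeOff R A s') {i : ℕ}
    (hi : i ∈ R) (x : ℕ) : s.AgreeOff R A (s'.writeReg i x) := by
  refine ⟨fun j hj => ?_, h.2⟩
  rw [Memory.reg_writeReg, if_neg (fun h => hj (by rwa [h])), h.1 j hj]

/-- Only counted loops are allowed, so every program has a total semantics `run`. Correctness
becomes a statement about functions on memories, and time is treated separately. -/
inductive LoopProgram : Type
  | skip
  | setReg (i : ℕ) (e : Expr)
  | setArr (a : ℕ) (e₁ e₂ e : Expr)
  | seq (P Q : LoopProgram)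
  | ite (e : Expr) (P Q : LoopProgram)
  | loop (i : ℕ) (P : LoopProgram)

/-- `iterate f i k s` runs `f` with register `i` set to `0, …, k-1`. -/
def Memory.iterate (f : Memory → Memory) (i : ℕ) : ℕ → Memory → Memory
  | 0, s => s.writeReg i 0
  | k + 1, s => (f (Memory.iterate f i k s)).writeReg i (k + 1)

namespace LoopProgram

/-- The final memory of a loop program. -/
def run : LoopProgram → Memory → Memory
  | skip, s => s
  | setReg i e, s => s.writeReg i (e.eval s)
  | setArr a e₁ e₂ e, s => s.writeArr a (e₁.eval s) (e₂.eval s) (e.eval s)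
  | seq P Q, s => Q.run (P.run s)
  | ite e P Q, s => if e.Holds s then P.run s else Q.run s
  | loop i P, s => Memory.iterate P.run i (s.reg 0) s

/-- The program on the random access machine. -/
def compile : LoopProgram → Program
  | skip => .skip
  | setReg i e => .setReg i e
  | setArr a e₁ e₂ e => .setArr a e₁ e₂ e
  | seq P Q => .seq P.compile Q.compile
  | ite e P Q => .ifThenElse e P.compile Q.compile
  | loop i P => .seq (.setReg i (.const 0)) (.while (.sub (.reg 0) (.reg i))
      (.seq P.compile (.setReg i (.add (.reg i) (.const 1)))))

/-- The registers that may be written. -/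
def regs : LoopProgram → List ℕ
  | skip => []
  | setReg i _ => [i]
  | setArr _ _ _ _ => []
  | seq P Q => P.regs ++ Q.regs
  | ite _ P Q => P.regs ++ Q.regs
  | loop i P => i :: P.regs

/-- The arrays that may be written. -/
def arrs : LoopProgram → List ℕ
  | skip => []
  | setReg _ _ => []
  | setArr a _ _ _ => [a]
  | seq P Q => P.arrs ++ Q.arrs
  | ite _ P Q => P.arrs ++ Q.arrs
  | loop _ P => P.arrs

/-- No loop counter is written by the body of its loop. -/
def WellFormed : LoopProgram → Prop
  | skip => True
  | setReg _ _ => True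
  | setArr _ _ _ _ => True
  | seq P Q => P.WellFormed ∧ Q.WellFormed
  | ite _ P Q => P.WellFormed ∧ Q.WellFormed
  | loop i P => i ∉ P.regs ∧ P.WellFormed

open Polynomial in
/-- A bound for the number of steps in terms of the content of register `0`. -/
noncomputable def cost : LoopProgram → ℕ[X]
  | skip => 1
  | setReg _ e => C (e.cost + 1)
  | setArr _ e₁ e₂ e => C (e₁.cost + e₂.cost + e.cost + 1)
  | seq P Q => P.cost + Q.cost
  -- The sum of both branches bounds the more expensive one and stays a polynomial.
  | ite e P Q => C (e.cost + 1) + (P.cost + Q.cost)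
  -- Initialising the counter takes 2 steps and the final failing test 4; each iteration adds 4 for
  -- the test and 4 for the increment.
  | loop _ P => C 6 + X * (P.cost + C 8)

theorem agreeOff_iterate {P : LoopProgram} (ih : ∀ s : Memory, s.AgreeOff P.regs P.arrs (P.run s))
    (i k : ℕ) (s : Memory) : s.AgreeOff (i :: P.regs) P.arrs (Memory.iterate P.run i k s) := by
  induction k with
  | zero => exact (Memory.AgreeOff.refl s).writeReg (by simp) _
  | succ k ihk => exact (ihk.trans ((ih _).mono (by simp) (by simp))).writeReg (by simp) _

/-- The frame rule: whatever a program does not mention as a target is unchanged, which later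
reduces to membership in explicit lists. -/
theorem agreeOff_run (P : LoopProgram) (s : Memory) : s.AgreeOff P.regs P.arrs (P.run s) := by
  induction P generalizing s with
  | skip => exact .refl s
  | setReg i e => exact (Memory.AgreeOff.refl s).writeReg (by simp [regs]) _
  | setArr a e₁ e₂ e =>
    refine ⟨fun _ _ => rfl, fun b hb => ?_⟩
    have hb : b ≠ a := by simpa [arrs] using hb
    funext i j
    simp [run, Memory.arr_writeArr, hb]
  | seq P Q ihP ihQ =>
    exact ((ihP s).mono (by simp [regs]) (by simp [arrs])).trans
      ((ihQ _).mono (by simp [regs]) (by simp [arrs]))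
  | ite e P Q ihP ihQ =>
    simp only [run]
    split
    · exact (ihP s).mono (by simp [regs]) (by simp [arrs])
    · exact (ihQ s).mono (by simp [regs]) (by simp [arrs])
  | loop i P ih => exact agreeOff_iterate ih i _ s

theorem run_reg {P : LoopProgram} {i : ℕ} (hi : i ∉ P.regs) (s : Memory) :
    (P.run s).reg i = s.reg i := (P.agreeOff_run s).1 i hi

theorem run_arr {P : LoopProgram} {a : ℕ} (ha : a ∉ P.arrs) (s : Memory) :
    (P.run s).arr a = s.arr a := (P.agreeOff_run s).2 a ha

theorem iterate_reg_counter (f : Memory → Memory) (i k : ℕ) (s : Memory) :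
    (Memory.iterate f i k s).reg i = k := by
  cases k <;> simp [Memory.iterate, Memory.reg_writeReg]

/-- Induction on the number `m` of iterations left. The body writes neither the counter nor register
`0`, so the machine's test and the iteration count stay in step. -/
theorem exec_while {P : LoopProgram} {i n c : ℕ} (hi0 : i ≠ 0) (hiP : i ∉ P.regs)
    (h0P : 0 ∉ P.regs)
    (ih : ∀ s : Memory, s.reg 0 = n → ∃ t ≤ c, Exec P.compile s t (P.run s)) {s : Memory}
    (hs : s.reg 0 = n) (m k : ℕ) (hk : k + m = n) :
    ∃ t ≤ m * (c + 8) + 4, Exec (.while (.sub (.reg 0) (.reg i))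
      (.seq P.compile (.setReg i (.add (.reg i) (.const 1)))))
      (Memory.iterate P.run i k s) t (Memory.iterate P.run i n s) := by
  have hreg0 : ∀ k, (Memory.iterate P.run i k s).reg 0 = n := fun k =>
    ((agreeOff_iterate P.agreeOff_run i k s).1 0 (by simp [h0P, hi0.symm])).trans hs
  induction m generalizing k with
  | zero =>
    obtain rfl : k = n := hk
    refine ⟨_, ?_, Exec.whileFalse ?_⟩
    · simp [Expr.cost]
    · simp [Expr.eval, hreg0, iterate_reg_counter]
  | succ m ihm =>
    obtain ⟨t, ht, hexec⟩ := ihm (k + 1) (by omega)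
    obtain ⟨t', ht', hexec'⟩ := ih _ (hreg0 k)
    have hstep := Exec.setReg i (.add (.reg i) (.const 1)) (P.run (Memory.iterate P.run i k s))
    have hval : (Expr.add (.reg i) (.const 1)).eval (P.run (Memory.iterate P.run i k s)) =
        k + 1 := by
      simp [Expr.eval, run_reg hiP, iterate_reg_counter]
    rw [hval] at hstep
    refine ⟨_, ?_, Exec.whileTrue ?_ (Exec.seq hexec' hstep) hexec⟩
    · simp only [Expr.cost]
      ring_nf at ht ⊢
      omega
    · simp only [Expr.eval, hreg0, iterate_reg_counter]; omega

/-- Register `0` is never written, so all parts of the program are bounded by polynomials at the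
same argument. -/
theorem exists_exec {P : LoopProgram} (hP : P.WellFormed) (h0 : 0 ∉ P.regs) (s : Memory) :
    ∃ t ≤ P.cost.eval (s.reg 0), Exec P.compile s t (P.run s) := by
  induction P generalizing s with
  | skip => exact ⟨1, by simp [cost], .skip s⟩
  | setReg i e => exact ⟨_, by simp [cost], .setReg i e s⟩
  | setArr a e₁ e₂ e => exact ⟨_, by simp [cost], .setArr a e₁ e₂ e s⟩
  | seq P Q ihP ihQ =>
    simp only [regs, List.mem_append, not_or] at h0
    obtain ⟨t, ht, hexec⟩ := ihP hP.1 h0.1 s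
    obtain ⟨t', ht', hexec'⟩ := ihQ hP.2 h0.2 (P.run s)
    rw [run_reg h0.1] at ht'
    exact ⟨t + t', by simp only [cost, Polynomial.eval_add]; omega, .seq hexec hexec'⟩
  | ite e P Q ihP ihQ =>
    simp only [regs, List.mem_append, not_or] at h0
    obtain ⟨t, ht, hexec⟩ := ihP hP.1 h0.1 s
    obtain ⟨t', ht', hexec'⟩ := ihQ hP.2 h0.2 s
    simp only [run, cost, Polynomial.eval_add, Polynomial.eval_C]
    by_cases he : e.Holds s
    · rw [if_pos he]
      exact ⟨_, by omega, .ifTrue he hexec⟩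
    · rw [if_neg he]
      exact ⟨_, by omega, .ifFalse (not_not.1 he) hexec'⟩
  | loop i P ih =>
    simp only [regs, List.mem_cons, not_or] at h0
    obtain ⟨t, ht, hexec⟩ := exec_while (c := P.cost.eval (s.reg 0)) (Ne.symm h0.1) hP.1 h0.2
      (fun s' hs' => by rw [← hs']; exact ih hP.2 h0.2 s') rfl (s.reg 0) 0 (zero_add _)
    refine ⟨_, ?_, Exec.seq (Exec.setReg i (.const 0) s) hexec⟩
    simp only [Expr.cost, cost, Polynomial.eval_add, Polynomial.eval_C, Polynomial.eval_mul,
      Polynomial.eval_X]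
    omega

theorem run_seq (P Q : LoopProgram) (s : Memory) : (seq P Q).run s = Q.run (P.run s) := rfl

theorem run_ite (e : Expr) (P Q : LoopProgram) (s : Memory) :
    (ite e P Q).run s = if e.Holds s then P.run s else Q.run s := rfl

theorem run_setReg (i : ℕ) (e : Expr) (s : Memory) :
    (setReg i e).run s = s.writeReg i (e.eval s) := rfl

theorem run_setArr (a : ℕ) (e₁ e₂ e : Expr) (s : Memory) :
    (setArr a e₁ e₂ e).run s = s.writeArr a (e₁.eval s) (e₂.eval s) (e.eval s) := rfl

theorem run_skip (s : Memory) : skip.run s = s := rfl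

/-- The rule for loops with an invariant. -/
theorem run_loop_induction {i : ℕ} {P : LoopProgram} {s : Memory} (I : ℕ → Memory → Prop)
    (h0 : I 0 (s.writeReg i 0))
    (hstep : ∀ k s', k < s.reg 0 → s'.reg i = k → s.AgreeOff (i :: P.regs) P.arrs s' → I k s' →
      I (k + 1) ((P.run s').writeReg i (k + 1))) :
    I (s.reg 0) ((loop i P).run s) := by
  have : ∀ k ≤ s.reg 0, I k (Memory.iterate P.run i k s) := by
    intro k
    induction k with
    | zero => exact fun _ => h0
    | succ k ih =>
      exact fun hk => hstep k _ (by omega) (iterate_reg_counter _ _ _ _)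
        (agreeOff_iterate P.agreeOff_run i k s) (ih (by omega))
  exact this _ le_rfl

/-- A loop over the rows of an array. -/
theorem run_loop_row {i a : ℕ} {P : LoopProgram} {s : Memory} (hP : P.arrs ⊆ [a])
    (g : ℕ → ℕ → ℕ)
    (h : ∀ k s', k < s.reg 0 → s'.reg i = k → s.AgreeOff (i :: P.regs) [a] s' →
      (∀ y, s'.arr a k y = s.arr a k y) →
      ∀ x y, (P.run s').arr a x y = if x = k then g k y else s'.arr a x y) (x y : ℕ) :
    ((loop i P).run s).arr a x y = if x < s.reg 0 then g x y else s.arr a x y := by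
  refine run_loop_induction (i := i) (P := P) (s := s)
    (fun k s' => ∀ x y, s'.arr a x y = if x < k then g x y else s.arr a x y)
    (by simp [Memory.arr_writeReg]) ?_ x y
  intro k s' hk hi hs' hI x y
  rw [Memory.arr_writeReg, h k s' hk hi (hs'.mono (by simp) hP) (fun y => by simp [hI])]
  split_ifs with h1 h2 h2
  · rw [h1]
  · omega
  · rw [hI, if_pos (by omega)]
  · rw [hI, if_neg (by omega)]

/-- A loop over the entries of a row of an array. -/
theorem run_loop_column {i a r : ℕ} {P : LoopProgram} {s : Memory} (hP : P.arrs ⊆ [a])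
    (g : ℕ → ℕ)
    (h : ∀ k s', k < s.reg 0 → s'.reg i = k → s.AgreeOff (i :: P.regs) [a] s' →
      s'.arr a r k = s.arr a r k →
      ∀ x y, (P.run s').arr a x y = if x = r ∧ y = k then g k else s'.arr a x y) (x y : ℕ) :
    ((loop i P).run s).arr a x y = if x = r ∧ y < s.reg 0 then g y else s.arr a x y := by
  refine run_loop_induction (i := i) (P := P) (s := s)
    (fun k s' => ∀ x y, s'.arr a x y = if x = r ∧ y < k then g y else s.arr a x y)
    (by simp [Memory.arr_writeReg]) ?_ x y
  intro k s' hk hi hs' hI x y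
  rw [Memory.arr_writeReg, h k s' hk hi (hs'.mono (by simp) hP) (by simp [hI])]
  split_ifs with h1 h2 h2
  · rw [h1.2]
  · omega
  · rw [hI, if_pos (by omega)]
  · rw [hI, if_neg (by omega)]

/-! ### Universal tests, tables and conditional updates -/

/-- Register `f` is set to `1` if the test `e` succeeds for all values of register `x` below `n`,
and to `0` otherwise. -/
def testAll (x f : ℕ) (e : Expr) : LoopProgram :=
  seq (setReg f (.const 1)) (loop x (ite e skip (setReg f (.const 0))))

theorem testAll_reg {x f : ℕ} {e : Expr} (hf : f ∉ e.regs) (hxf : x ≠ f) (hf0 : f ≠ 0)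
    (s : Memory) :
    ((testAll x f e).run s).reg f = if ∀ k < s.reg 0, e.Holds (s.writeReg x k) then 1 else 0 := by
  rw [testAll, run_seq, run_setReg]
  have hn : (s.writeReg f ((Expr.const 1).eval s)).reg 0 = s.reg 0 := by
    simp [Memory.reg_writeReg, hf0.symm]
  rw [← hn]
  refine run_loop_induction
    (fun k s' => s'.reg f = if ∀ j < k, e.Holds (s.writeReg x j) then 1 else 0) ?_ ?_
  · simp [Memory.reg_writeReg, hxf.symm, Expr.eval]
  · intro k s' _ hi hs' hI
    -- The test does not read the flag `f`, so it can be evaluated in the original memory.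
    have he : e.Holds s' ↔ e.Holds (s.writeReg x k) := by
      unfold Expr.Holds
      rw [Expr.eval_congr (s := s.writeReg x k)]
      · intro j hj
        have hjf : j ≠ f := fun h => hf (h ▸ hj)
        by_cases hjx : j = x
        · simp [hjx, hi, Memory.reg_writeReg]
        · rw [hs'.1 j (by simp [regs, hjx, hjf])]
          simp [Memory.reg_writeReg, hjx, hjf]
      · intro a _
        exact hs'.2 a (by simp [arrs])
    have hsucc : (∀ j < k + 1, e.Holds (s.writeReg x j)) ↔
        (∀ j < k, e.Holds (s.writeReg x j)) ∧ e.Holds (s.writeReg x k) := by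
      simp [Order.lt_add_one_iff, le_iff_lt_or_eq, or_imp, forall_and]
    rw [Memory.reg_writeReg, if_neg hxf.symm, run_ite]
    split
    · rename_i h
      rw [run_skip, hI]
      simp only [hsucc, he.1 h, and_true]
    · rename_i h
      rw [he] at h
      simp only [run_setReg, Memory.reg_writeReg, Expr.eval, hsucc, h, and_false, if_true, if_false]

/-- Position `(v, 0)` of array `a` is set to `1` if the test `e` succeeds for all values of
register `x`, and to `0` otherwise. -/
def tabulate (v x f a : ℕ) (e : Expr) : LoopProgram :=
  loop v (seq (testAll x f e) (setArr a (.reg v) (.const 0) (.reg f)))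

theorem tabulate_arr {v x f a : ℕ} {e : Expr} (hf : f ∉ e.regs) (ha : a ∉ e.arrs)
    (hd : [0, v, x, f].Nodup) (s : Memory) {k : ℕ} (hk : k < s.reg 0) :
    ((tabulate v x f a e).run s).arr a k 0 ≠ 0 ↔
      ∀ j < s.reg 0, e.Holds ((s.writeReg v k).writeReg x j) := by
  simp only [List.nodup_cons, List.mem_cons, List.not_mem_nil, or_false, not_or] at hd
  obtain ⟨⟨h0v, h0x, h0f⟩, ⟨hvx, hvf⟩, hxf, -⟩ := hd
  rw [tabulate, run_loop_row (by simp [arrs, testAll])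
    (fun k y => if y = 0 then
      if ∀ j < s.reg 0, e.Holds ((s.writeReg v k).writeReg x j) then 1 else 0 else s.arr a k y)]
  · simp [hk]
  · intro k s' hk hv hs' hrow p q
    have hv' : ((testAll x f e).run s').reg v = k := by
      rw [run_reg (by simp [testAll, regs, hvx, hvf]), hv]
    have h0' : s'.reg 0 = s.reg 0 := hs'.1 0 (by simp [testAll, regs, h0v, h0x, h0f])
    have hall : (∀ j < s'.reg 0, e.Holds (s'.writeReg x j)) ↔
        ∀ j < s.reg 0, e.Holds ((s.writeReg v k).writeReg x j) := by
      rw [h0']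
      refine forall_congr' fun j => imp_congr_right fun _ => ?_
      unfold Expr.Holds
      rw [Expr.eval_congr (s := (s.writeReg v k).writeReg x j)]
      · intro i hi
        have hif : i ≠ f := fun h => hf (h ▸ hi)
        simp only [Memory.reg_writeReg]
        split_ifs with h1 h2
        · rfl
        · rw [h2, hv]
        · exact hs'.1 i (by simp [testAll, regs, h1, h2, hif])
      · intro b hb
        exact hs'.2 b (by simpa using fun h : b = a => ha (h ▸ hb))
    rw [run_seq, run_setArr, Memory.arr_writeArr, run_arr (by simp [testAll, arrs])]
    simp only [Expr.eval, hv', testAll_reg hf hxf (Ne.symm h0f), true_and, hall]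
    by_cases hp : p = k
    · subst hp
      by_cases hq : q = 0
      · simp [hq]
      · simp [hq, hrow]
    · simp [hp]

/-- Position `(v, u)` of array `a` is set to `1` if the test `e` succeeds for all values of
register `x`, and to `0` otherwise. -/
def tabulate₂ (v u x f a : ℕ) (e : Expr) : LoopProgram :=
  loop v (loop u (seq (testAll x f e) (setArr a (.reg v) (.reg u) (.reg f))))

theorem tabulate₂_arr {v u x f a : ℕ} {e : Expr} (hf : f ∉ e.regs) (ha : a ∉ e.arrs)
    (hd : [0, v, u, x, f].Nodup) (s : Memory) {k l : ℕ} (hk : k < s.reg 0) (hl : l < s.reg 0) :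
    ((tabulate₂ v u x f a e).run s).arr a k l ≠ 0 ↔
      ∀ j < s.reg 0, e.Holds (((s.writeReg v k).writeReg u l).writeReg x j) := by
  simp only [List.nodup_cons, List.mem_cons, List.not_mem_nil, or_false, not_or] at hd
  obtain ⟨⟨h0v, h0u, h0x, h0f⟩, ⟨hvu, hvx, hvf⟩, ⟨hux, huf⟩, hxf, -⟩ := hd
  rw [tabulate₂, run_loop_row (by simp [arrs, testAll])
    (fun k y => if y < s.reg 0 then
      if ∀ j < s.reg 0, e.Holds (((s.writeReg v k).writeReg u y).writeReg x j) then 1 else 0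
      else s.arr a k y)]
  · simp [hk, hl]
  · intro k s' hk hv hs' hrow p q
    have h0' : s'.reg 0 = s.reg 0 := hs'.1 0 (by simp [testAll, regs, h0v, h0x, h0f, h0u])
    rw [run_loop_column (r := k) (by simp [arrs, testAll])
      (fun y => if ∀ j < s.reg 0, e.Holds (((s.writeReg v k).writeReg u y).writeReg x j)
        then 1 else 0), h0']
    · by_cases hp : p = k
      · subst hp
        simp [hrow]
      · simp [hp]
    · intro l s'' hl hu hs'' _ p q
      have hv' : ((testAll x f e).run s'').reg v = k := by
        rw [run_reg (by simp [testAll, regs, hvx, hvf]),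
          hs''.1 v (by simp [testAll, regs, hvx, hvf, hvu]), hv]
      have hu' : ((testAll x f e).run s'').reg u = l := by
        rw [run_reg (by simp [testAll, regs, hux, huf]), hu]
      have h0'' : s''.reg 0 = s.reg 0 := by
        rw [hs''.1 0 (by simp [testAll, regs, h0x, h0f, h0u]), h0']
      have hall : (∀ j < s''.reg 0, e.Holds (s''.writeReg x j)) ↔
          ∀ j < s.reg 0, e.Holds (((s.writeReg v k).writeReg u l).writeReg x j) := by
        rw [h0'']
        refine forall_congr' fun j => imp_congr_right fun _ => ?_
        unfold Expr.Holds
        rw [Expr.eval_congr (s := ((s.writeReg v k).writeReg u l).writeReg x j)]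
        · intro i hi
          have hif : i ≠ f := fun h => hf (h ▸ hi)
          simp only [Memory.reg_writeReg]
          split_ifs with h1 h2 h3
          · rfl
          · rw [h2, hu]
          · rw [h3, hs''.1 v (by simp [testAll, regs, hvx, hvf, hvu]), hv]
          · rw [hs''.1 i (by simp [testAll, regs, h1, h2, hif]),
              hs'.1 i (by simp [testAll, regs, h1, h2, h3, hif])]
        · intro b hb
          have hba : b ∉ [a] := by simpa using fun h : b = a => ha (h ▸ hb)
          exact (hs''.2 b hba).trans (hs'.2 b hba)
      rw [run_seq, run_setArr, Memory.arr_writeArr, run_arr (by simp [testAll, arrs])]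
      simp only [Expr.eval, hv', hu', testAll_reg hf hxf (Ne.symm h0f), true_and, hall]

/-- Position `(v, 0)` of array `a` is set to `e'` if the test `e` succeeds. -/
def update (v a : ℕ) (e e' : Expr) : LoopProgram :=
  loop v (ite e (setArr a (.reg v) (.const 0) e') skip)

theorem update_arr {v a : ℕ} {e e' : Expr} (ha : a ∉ e.arrs) (ha' : a ∉ e'.arrs)
    (s : Memory) (x y : ℕ) :
    ((update v a e e').run s).arr a x y =
      if x < s.reg 0 ∧ y = 0 ∧ e.Holds (s.writeReg v x) then e'.eval (s.writeReg v x)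
      else s.arr a x y := by
  rw [update, run_loop_row (by simp [arrs])
    (fun k y => if y = 0 ∧ e.Holds (s.writeReg v k) then e'.eval (s.writeReg v k)
      else s.arr a k y)]
  · split_ifs <;> simp_all
  · intro k s' hk hv hs' hrow p q
    have hcongr : ∀ d : Expr, a ∉ d.arrs → d.eval s' = d.eval (s.writeReg v k) := by
      intro d hd
      refine Expr.eval_congr (fun i _ => ?_) fun b hb => ?_
      · rw [Memory.reg_writeReg]
        split_ifs with h
        · rw [h, hv]
        · exact hs'.1 i (by simp [regs, h])
      · exact hs'.2 b (by simpa using fun h : b = a => hd (h ▸ hb))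
    have he : e.Holds s' ↔ e.Holds (s.writeReg v k) := by
      unfold Expr.Holds; rw [hcongr e ha]
    rw [run_ite]
    by_cases hh : e.Holds (s.writeReg v k)
    · rw [if_pos (he.2 hh), run_setArr, Memory.arr_writeArr, hcongr e' ha']
      simp only [Expr.eval, hv, true_and, hh, and_true]
      by_cases hp : p = k
      · subst hp
        simp [hrow]
      · simp [hp]
    · rw [if_neg (he.not.2 hh), run_skip]
      by_cases hp : p = k
      · subst hp
        simp [hrow, hh]
      · simp [hp]

/-- Position `(v, u)` of array `a` is set to `e'` if the test `e` succeeds. -/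
def update₂ (v u a : ℕ) (e e' : Expr) : LoopProgram :=
  loop v (loop u (ite e (setArr a (.reg v) (.reg u) e') skip))

theorem update₂_arr {v u a : ℕ} {e e' : Expr} (ha : a ∉ e.arrs) (ha' : a ∉ e'.arrs)
    (hd : [0, v, u].Nodup) (s : Memory) (x y : ℕ) :
    ((update₂ v u a e e').run s).arr a x y =
      if x < s.reg 0 ∧ y < s.reg 0 ∧ e.Holds ((s.writeReg v x).writeReg u y)
      then e'.eval ((s.writeReg v x).writeReg u y) else s.arr a x y := by
  simp only [List.nodup_cons, List.mem_cons, List.not_mem_nil, or_false, not_or] at hd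
  obtain ⟨⟨h0v, h0u⟩, hvu, -⟩ := hd
  rw [update₂, run_loop_row (by simp [arrs])
    (fun k y => if y < s.reg 0 ∧ e.Holds ((s.writeReg v k).writeReg u y)
      then e'.eval ((s.writeReg v k).writeReg u y) else s.arr a k y)]
  · split_ifs <;> simp_all
  · intro k s' hk hv hs' hrow p q
    have h0' : s'.reg 0 = s.reg 0 := hs'.1 0 (by simp [regs, h0v, h0u])
    rw [run_loop_column (r := k) (by simp [arrs])
      (fun y => if e.Holds ((s.writeReg v k).writeReg u y)
        then e'.eval ((s.writeReg v k).writeReg u y) else s.arr a k y), h0']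
    · by_cases hp : p = k
      · subst hp
        simp only [true_and, if_true, hrow]
        split_ifs <;> simp_all
      · simp [hp]
    · intro l s'' hl hu hs'' hentry p q
      have hv' : s''.reg v = k := by rw [hs''.1 v (by simp [regs, hvu]), hv]
      have hcongr : ∀ d : Expr, a ∉ d.arrs →
          d.eval s'' = d.eval ((s.writeReg v k).writeReg u l) := by
        intro d hd
        refine Expr.eval_congr (fun i _ => ?_) fun b hb => ?_
        · simp only [Memory.reg_writeReg]
          split_ifs with h h'
          · rw [h, hu]
          · rw [h', hv']
          · rw [hs''.1 i (by simp [regs, h]), hs'.1 i (by simp [regs, h, h'])]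
        · have hba : b ∉ [a] := by simpa using fun h : b = a => hd (h ▸ hb)
          exact (hs''.2 b hba).trans (hs'.2 b hba)
      have he : e.Holds s'' ↔ e.Holds ((s.writeReg v k).writeReg u l) := by
        unfold Expr.Holds; rw [hcongr e ha]
      rw [run_ite]
      by_cases hh : e.Holds ((s.writeReg v k).writeReg u l)
      · rw [if_pos (he.2 hh), run_setArr, Memory.arr_writeArr, hcongr e' ha']
        simp [Expr.eval, hv', hu, hh]
      · rw [if_neg (he.not.2 hh), run_skip]
        by_cases hpq : p = k ∧ q = l
        · obtain ⟨rfl, rfl⟩ := hpq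
          simp [hentry, hrow, hh]
        · simp [hpq]

end LoopProgram

/-! ### Bipartite matching by auction

Bidders in `L` compete for the objects below `n` that they are joined to by `E`. A bidder without
an object takes the cheapest object joined to it, whose price `p` then rises by one; `o` and `a`
record, increased by one, the owner of every object and the object of every bidder. -/

/-- `price` expresses that an object that has received a bid never becomes free again. `cheap` is
approximate optimality: the object held costs at most one more than any object joined to its bidder.
-/
structure IsAuctionState (n : ℕ) (L : ℕ → Prop) (E : ℕ → ℕ → Prop) (p o a : ℕ → ℕ) : Prop where
  assigned : ∀ v u, L v → a v = u + 1 → E v u ∧ o u = v + 1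
  owned : ∀ v u, u < n → o u = v + 1 → L v ∧ a v = u + 1
  price : ∀ u < n, p u ≠ 0 → o u ≠ 0
  cheap : ∀ v u, L v → a v = u + 1 → ∀ u', E v u' → p u ≤ p u' + 1

section Auction

variable {n : ℕ} {L : ℕ → Prop} {E : ℕ → ℕ → Prop} {p o a : ℕ → ℕ}

/-- Prices only rise, which keeps `cheap` for the bidders whose object is untouched. The new owner
chose a cheapest object, so the rise by one is within the tolerance, and the former owner holds
nothing. -/
theorem IsAuctionState.bid (h : IsAuctionState n L E p o a) (hE : ∀ v u, E v u → u < n)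
    {v u : ℕ} (hv : L v) (hav : a v = 0) (hu : E v u) (hmin : ∀ u', E v u' → p u ≤ p u') :
    IsAuctionState n L E (fun x => if x = u then p u + 1 else p x)
      (fun x => if x = u then v + 1 else o x)
      (fun x => if x = v then u + 1 else if o u = x + 1 then 0 else a x) := by
  have hun := hE v u hu
  constructor
  · intro v' u' hv' ha
    by_cases hvv : v' = v
    · subst hvv
      obtain rfl : u = u' := by simpa using ha
      simp [hu]
    · simp only [hvv, if_false] at ha
      split_ifs at ha with ho
      obtain ⟨h1, h2⟩ := h.assigned v' u' hv' ha
      have : u' ≠ u := by rintro rfl; exact ho h2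
      simp [this, h1, h2]
  · intro v' u' hu' ho
    by_cases huu : u' = u
    · subst huu
      obtain rfl : v = v' := by simpa using ho
      simp [hv]
    · simp only [huu, if_false] at ho
      obtain ⟨h1, h2⟩ := h.owned v' u' hu' ho
      have h3 : v' ≠ v := by rintro rfl; omega
      have h4 : o u ≠ v' + 1 := fun h4 => by
        have := (h.owned v' u hun h4).2
        omega
      simp [h1, h2, h3, h4]
  · intro u' hu' hp
    by_cases huu : u' = u
    · simp [huu]
    · simp only [huu, if_false] at hp ⊢
      exact h.price u' hu' hp
  · intro v' u' hv' ha u'' hu''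
    have hmono : p u'' ≤ if u'' = u then p u + 1 else p u'' := by
      split_ifs with h'
      · rw [h']; omega
      · rfl
    by_cases hvv : v' = v
    · subst hvv
      obtain rfl : u = u' := by simpa using ha
      have := hmin u'' hu''
      simp only [if_true]
      omega
    · simp only [hvv, if_false] at ha
      split_ifs at ha with ho
      have h2 := (h.assigned v' u' hv' ha).2
      have : u' ≠ u := by rintro rfl; exact ho h2
      have := h.cheap v' u' hv' ha u'' hu''
      simp only [*, if_false]
      omega

/-- If all bidders can be served, then every bidder without an object finds a cheap one. -/
theorem IsAuctionState.exists_cheap (h : IsAuctionState n L E p o a) (hL : ∀ v, L v → v < n)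
    {q : ℕ → ℕ} (hq : ∀ v, L v → E v (q v) ∧ q v < n ∧ ¬ L (q v))
    (hqinj : ∀ v w, L v → L w → q v = q w → v = w) {v : ℕ} (hv : L v) (hav : a v = 0) :
    ∃ u, E v u ∧ p u + 1 < n := by
  classical
  by_contra! hn
  -- `S c` consists of the objects outside `L` of price at least `c`. If every object wanted by `v`
  -- had price at least `n - 1`, these sets would gain an element at each of the levels `n - 1, …,
  -- 0`, too many for `S 0`.
  let S : ℕ → Finset ℕ := fun c => (Finset.range n).filter fun u => ¬ L u ∧ c ≤ p u
  have hstep : ∀ c, c + 1 < n → (S (c + 1)).card + 1 ≤ (S c).card := by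
    intro c hc
    -- The owners of the objects in `S (c + 1)` together with `v` want only objects of price at
    -- least `c`, so `q` embeds them into `S c`.
    let T := insert v ((S (c + 1)).image fun u => o u - 1)
    have hown : ∀ u ∈ S (c + 1), ∃ w, o u = w + 1 ∧ L w ∧ a w = u + 1 := by
      intro u hu
      simp only [S, Finset.mem_filter, Finset.mem_range] at hu
      obtain ⟨w, hw⟩ := Nat.exists_eq_succ_of_ne_zero (h.price u hu.1 (by omega))
      exact ⟨w, hw, h.owned w u hu.1 hw⟩
    have hT : T.card = (S (c + 1)).card + 1 := by
      rw [Finset.card_insert_of_notMem, Finset.card_image_of_injOn]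
      · intro u hu u' hu' huu
        obtain ⟨w, hw, -, haw⟩ := hown u hu
        obtain ⟨w', hw', -, haw'⟩ := hown u' hu'
        simp only [hw, hw', Nat.add_sub_cancel] at huu
        subst huu
        omega
      · intro hmem
        obtain ⟨u, hu, huv⟩ := Finset.mem_image.1 hmem
        obtain ⟨w, hw, -, haw⟩ := hown u hu
        rw [hw, Nat.add_sub_cancel] at huv
        subst huv
        omega
    have hTL : ∀ w ∈ T, L w ∧ ∀ u, E w u → c ≤ p u := by
      intro w hw
      rcases Finset.mem_insert.1 hw with rfl | hw
      · exact ⟨hv, fun u hu => by have := hn u hu; omega⟩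
      · obtain ⟨u, hu, rfl⟩ := Finset.mem_image.1 hw
        obtain ⟨w, hw, hLw, haw⟩ := hown u hu
        rw [hw, Nat.add_sub_cancel]
        refine ⟨hLw, fun u' hu' => ?_⟩
        have := h.cheap w u hLw haw u' hu'
        simp only [S, Finset.mem_filter] at hu
        omega
    rw [← hT]
    refine Finset.card_le_card_of_injOn q (fun w hw => ?_) fun w hw w' hw' hww =>
      hqinj w w' (hTL w hw).1 (hTL w' hw').1 hww
    obtain ⟨hLw, hp⟩ := hTL w hw
    obtain ⟨h1, h2, h3⟩ := hq w hLw
    simpa [S, h2, h3] using hp _ h1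
  have hv' := hL v hv
  have hcount : ∀ j, j < n → (S (n - 1)).card + j ≤ (S (n - 1 - j)).card := by
    intro j
    induction j with
    | zero => simp
    | succ j ih =>
      intro hj
      have h1 := ih (by omega)
      have h2 := hstep (n - 1 - (j + 1)) (by omega)
      rw [show n - 1 - (j + 1) + 1 = n - 1 - j by omega] at h2
      omega
  have htop : 0 < (S (n - 1)).card := by
    obtain ⟨h1, h2, h3⟩ := hq v hv
    refine Finset.card_pos.2 ⟨q v, ?_⟩
    have := hn _ h1
    simp only [S, Finset.mem_filter, Finset.mem_range]
    exact ⟨h2, h3, by omega⟩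
  -- The bidder `v` is itself below `n` and not an object outside `L`.
  have hbot : (S 0).card ≤ n - 1 := by
    calc (S 0).card ≤ ((Finset.range n).erase v).card := by
          refine Finset.card_le_card fun u hu => ?_
          simp only [S, Finset.mem_filter] at hu
          exact Finset.mem_erase.2 ⟨fun h => hu.2.1 (h ▸ hv), hu.1⟩
      _ = n - 1 := by rw [Finset.card_erase_of_mem (by simpa using hv'), Finset.card_range]
  have := hcount (n - 1) (by omega)
  rw [Nat.sub_self] at this
  omega

/-- The state after `j` bids: either all bidders are served, or the prices have risen `j` times. -/
def AuctionProgress (n : ℕ) (L : ℕ → Prop) (p a : ℕ → ℕ) (j : ℕ) : Prop :=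
  (∀ u < n, p u < n) ∧ ((∀ v, L v → a v ≠ 0) ∨ ∑ u ∈ Finset.range n, p u = j)

/-- If some bidder exists, then `n` is positive, and `n` prices below `n` cannot sum to `n * n`. -/
theorem AuctionProgress.all_served (h : AuctionProgress n L p a (n * n))
    (hL : ∀ v, L v → v < n) : ∀ v, L v → a v ≠ 0 := by
  refine h.2.elim id fun hsum v hv => ?_
  have hvn := hL v hv
  have : ∑ u ∈ Finset.range n, p u < ∑ _u ∈ Finset.range n, n := by
    refine Finset.sum_lt_sum_of_nonempty ⟨v, by simpa using hvn⟩ fun u hu =>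
      h.1 u (by simpa using hu)
  simp [hsum] at this

end Auction

/-! ### The program

Register `0` holds `n`, register `2` the number of slots, register `3` is nonzero as long as no
failure has occurred, register `4` holds the number of slots left to compute. Array `0` is the
adjacency matrix and arrays `1`, `2`, `3` hold the slots found so far, so that a vertex `v` is
present when array `1` holds `0` at `(v, 0)`. Within a round, array `6` holds the relation
`N[v] ⊆ N[u]`, array `7` the indicator function of a transversal `L`, arrays `8`, `9`, `10` the
prices, owners and assignments of the auction that matches `L` with the remaining vertices, and
array `11` the outcome of the final test at every vertex. -/

namespace LoopProgram

/-- Register `r` is set to `k + 1` for the last value `k` of register `v` for which the test `e`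
succeeds, and to `0` if there is none. -/
def search (v r : ℕ) (e : Expr) : LoopProgram :=
  seq (setReg r (.const 0)) (loop v (ite e (setReg r (.add (.reg v) (.const 1))) skip))

theorem search_reg {v r : ℕ} {e : Expr} (hr : r ∉ e.regs) (hvr : v ≠ r) (hr0 : r ≠ 0)
    (s : Memory) :
    (((search v r e).run s).reg r = 0 ∧ ∀ k < s.reg 0, ¬ e.Holds (s.writeReg v k)) ∨
      ∃ k < s.reg 0, ((search v r e).run s).reg r = k + 1 ∧ e.Holds (s.writeReg v k) := by
  rw [search, run_seq, run_setReg]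
  have hn : (s.writeReg r ((Expr.const 0).eval s)).reg 0 = s.reg 0 := by
    simp [Memory.reg_writeReg, hr0.symm]
  rw [← hn]
  refine run_loop_induction
    (fun k s' => (s'.reg r = 0 ∧ ∀ j < k, ¬ e.Holds (s.writeReg v j)) ∨
      ∃ j < k, s'.reg r = j + 1 ∧ e.Holds (s.writeReg v j)) ?_ ?_
  · simp [Memory.reg_writeReg, hvr.symm, Expr.eval]
  · intro k s' _ hi hs' hI
    have he : e.Holds s' ↔ e.Holds (s.writeReg v k) := by
      unfold Expr.Holds
      rw [Expr.eval_congr (s := s.writeReg v k)]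
      · intro j hj
        have hjr : j ≠ r := fun h => hr (h ▸ hj)
        by_cases hjv : j = v
        · simp [hjv, hi, Memory.reg_writeReg]
        · rw [hs'.1 j (by simp [regs, hjv, hjr])]
          simp [Memory.reg_writeReg, hjv, hjr]
      · intro a _
        exact hs'.2 a (by simp [arrs])
    rw [Memory.reg_writeReg, if_neg hvr.symm, run_ite]
    split
    · rename_i h
      exact Or.inr ⟨k, by omega, by simp [run_setReg, Memory.reg_writeReg, Expr.eval, hi],
        he.1 h⟩
    · rename_i h
      rw [he] at h
      rw [run_skip]
      rcases hI with ⟨h1, h2⟩ | ⟨j, hj, h1, h2⟩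
      · refine Or.inl ⟨h1, fun j hj => ?_⟩
        rcases Nat.lt_succ_iff_lt_or_eq.1 hj with hj | rfl
        · exact h2 j hj
        · exact h
      · exact Or.inr ⟨j, by omega, h1, h2⟩

end LoopProgram

/-! ### The code of the solver -/

namespace Solver

open _root_.GraphGrowth.Expr _root_.GraphGrowth.LoopProgram

/-- The entry of the one-dimensional array `a` at `e`. -/
def entry (a : ℕ) (e : Expr) : Expr := get a e (const 0)

theorem holds_entry {s : Memory} {a : ℕ} {e : Expr} :
    Holds s (entry a e) ↔ s.arr a (e.eval s) 0 ≠ 0 := Iff.rfl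

def present (e : Expr) : Expr := not (entry 1 e)

/-- Registers `11` and `12` are not tested for presence, so the table is meaningful only for present
vertices. -/
def dominance : LoopProgram :=
  tabulate₂ 11 12 13 20 6
    (imp (and (present (reg 13)) (or (eq (reg 13) (reg 11)) (get 0 (reg 11) (reg 13))))
      (or (eq (reg 13) (reg 12)) (get 0 (reg 12) (reg 13))))

/-- Minimality selects the twin classes, and the comparison of indices selects one vertex in each.
-/
def representatives : LoopProgram :=
  tabulate 11 13 20 7
    (and (present (reg 11)) (imp (and (present (reg 13)) (get 6 (reg 13) (reg 11)))
      (and (get 6 (reg 11) (reg 13)) (le (reg 11) (reg 13)))))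

def reset : LoopProgram :=
  seq (update 11 8 (const 1) (const 0))
    (seq (update 11 9 (const 1) (const 0)) (update 11 10 (const 1) (const 0)))

/-- The bidder is `reg 21 - 1`; the cheapest object joined to it becomes `reg 22 - 1`. -/
def cheapest : LoopProgram :=
  seq (setReg 22 (const 0))
    (loop 12 (ite (and (and (present (reg 12)) (and (not (entry 7 (reg 12)))
        (get 6 (sub (reg 21) (const 1)) (reg 12))))
        (or (not (reg 22)) (lt (entry 8 (reg 12)) (entry 8 (sub (reg 22) (const 1))))))
      (setReg 22 (add (reg 12) (const 1))) skip))

/-- The object `reg 22 - 1` passes to the bidder `reg 21 - 1`. -/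
def assign : LoopProgram :=
  seq (ite (entry 9 (sub (reg 22) (const 1)))
      (setArr 10 (sub (entry 9 (sub (reg 22) (const 1))) (const 1)) (const 0) (const 0)) skip)
    (seq (setArr 10 (sub (reg 21) (const 1)) (const 0) (reg 22))
      (seq (setArr 9 (sub (reg 22) (const 1)) (const 0) (reg 21))
        (setArr 8 (sub (reg 22) (const 1)) (const 0)
          (add (entry 8 (sub (reg 22) (const 1))) (const 1)))))

def bid : LoopProgram :=
  seq (search 11 21 (and (entry 7 (reg 11)) (not (entry 10 (reg 11)))))
    (ite (reg 21) (seq cheapest (ite (reg 22) assign skip)) skip)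

/-- With all prices below `n`, a total of `n * n` effective bids is impossible, so this many
attempts suffice. -/
def auction : LoopProgram := loop 14 (loop 15 bid)

/-- Requiring every present vertex outside `L` to be owned replaces a count: together with the
assignments it forces `L` to be half of the vertices. -/
def verify : LoopProgram :=
  seq (tabulate 11 13 20 11
      (and (imp (entry 7 (reg 11)) (entry 10 (reg 11)))
        (and (imp (and (present (reg 11)) (not (entry 7 (reg 11)))) (entry 9 (reg 11)))
          (not (and (entry 7 (reg 11)) (and (entry 7 (reg 13)) (get 0 (reg 11) (reg 13))))))))
    (testAll 13 3 (entry 11 (reg 13)))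

/-- The search for a valid set. -/
def matching : LoopProgram :=
  seq dominance (seq representatives (seq reset (seq auction verify)))

/-- The slot found is recorded, and the valid set is removed. -/
def record : LoopProgram :=
  seq (update 11 2 (entry 7 (reg 11)) (sub (entry 10 (reg 11)) (const 1)))
    (seq (update₂ 11 12 3 (and (entry 7 (reg 11)) (and (present (reg 12))
        (get 0 (reg 11) (reg 12)))) (const 1))
      -- The birth slots come after the activated edges, because `present` reads array `1`.
      (seq (update 11 1 (entry 7 (reg 11)) (reg 4)) (setReg 4 (sub (reg 4) (const 1)))))

def round : LoopProgram := seq matching (ite (reg 3) record skip)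

/-- Registers `2` and `4` are set to the binary logarithm of `n`. -/
def logarithm : LoopProgram :=
  seq (setReg 5 (const 1))
    (seq (loop 10 (ite (lt (reg 5) (reg 0))
      (seq (setReg 5 (add (reg 5) (reg 5))) (setReg 2 (add (reg 2) (const 1)))) skip))
      (setReg 4 (reg 2)))

/-- The outer loop runs `n` times, more often than there are slots; its test makes the surplus
rounds idle. -/
def main : LoopProgram :=
  seq logarithm (seq (setReg 3 (const 1))
    (seq (loop 10 (ite (and (reg 3) (reg 4)) round skip))
      (seq (search 11 1 (present (reg 11))) (setReg 1 (sub (reg 1) (const 1))))))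

/-- Register `0` bounds all loops, so the answer is written there only at the very end; the double
negation normalises the flag to `0` or `1`. -/
def program : Program := .seq main.compile (.setReg 0 (not (not (reg 3))))

theorem main_wellFormed : main.WellFormed := by
  simp [main, logarithm, round, record, matching, verify, auction, bid, assign, cheapest, reset,
    representatives, dominance, search, update, update₂, tabulate, tabulate₂, testAll,
    WellFormed, LoopProgram.regs]

theorem zero_notMem_main_regs : 0 ∉ main.regs := by decide

/-! ### Correctness of the auction phase -/

theorem cheapest_spec {s : Memory} {v : ℕ} (hv : s.reg 21 = v + 1) :
    ((cheapest.run s).reg 22 = 0 ∧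
      ∀ u < s.reg 0, ¬ (s.arr 1 u 0 = 0 ∧ s.arr 7 u 0 = 0 ∧ s.arr 6 v u ≠ 0)) ∨
    ∃ u < s.reg 0, (cheapest.run s).reg 22 = u + 1 ∧
      (s.arr 1 u 0 = 0 ∧ s.arr 7 u 0 = 0 ∧ s.arr 6 v u ≠ 0) ∧
      ∀ u' < s.reg 0, s.arr 1 u' 0 = 0 ∧ s.arr 7 u' 0 = 0 ∧ s.arr 6 v u' ≠ 0 →
        s.arr 8 u 0 ≤ s.arr 8 u' 0 := by
  rw [cheapest, run_seq, run_setReg]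
  have hn : (s.writeReg 22 ((Expr.const 0).eval s)).reg 0 = s.reg 0 := by
    simp [Memory.reg_writeReg]
  rw [← hn]
  refine run_loop_induction (fun k s' => (s'.reg 22 = 0 ∧
      ∀ u < k, ¬ (s.arr 1 u 0 = 0 ∧ s.arr 7 u 0 = 0 ∧ s.arr 6 v u ≠ 0)) ∨
    ∃ u < k, s'.reg 22 = u + 1 ∧ (s.arr 1 u 0 = 0 ∧ s.arr 7 u 0 = 0 ∧ s.arr 6 v u ≠ 0) ∧
      ∀ u' < k, s.arr 1 u' 0 = 0 ∧ s.arr 7 u' 0 = 0 ∧ s.arr 6 v u' ≠ 0 →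
        s.arr 8 u 0 ≤ s.arr 8 u' 0) ?_ ?_
  · simp [Memory.reg_writeReg, Expr.eval]
  · intro k s' _ hi hs' hI
    have harr : s'.arr = s.arr := funext fun a => hs'.2 a (by simp [LoopProgram.arrs])
    have h21 : s'.reg 21 = v + 1 := by
      rw [hs'.1 21 (by decide), Memory.reg_writeReg, if_neg (by decide), hv]
    have hsucc : ∀ u < k + 1, u < k ∨ u = k := fun u hu => by omega
    rw [Memory.reg_writeReg, if_neg (by decide), run_ite]
    simp only [holds_and, holds_not, holds_or, holds_lt, holds_reg, present, entry, holds_get,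
      Expr.eval, hi, h21, harr, Nat.add_sub_cancel, not_not, run_setReg, run_skip]
    generalize hr : s'.reg 22 = r at *
    split_ifs with h
    · rw [Memory.reg_writeReg, if_pos rfl]
      obtain ⟨⟨h1, h2, h3⟩, h4⟩ := h
      refine Or.inr ⟨k, by omega, rfl, ⟨h1, h2, h3⟩, fun u' hu' hw => ?_⟩
      rcases hsucc u' hu' with hu' | rfl
      · rcases hI with ⟨-, h5⟩ | ⟨u, hu, rfl, hwu, h5⟩
        · exact absurd hw (h5 u' hu')
        · have := h5 u' hu' hw
          simp only [Nat.add_sub_cancel, Nat.add_eq_zero_iff, one_ne_zero, and_false,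
            false_or] at h4
          omega
      · rfl
    · rcases hI with ⟨h5, h6⟩ | ⟨u, hu, h5, hwu, h6⟩
      · refine Or.inl ⟨hr.trans h5, fun u hu => ?_⟩
        rcases hsucc u hu with hu | rfl
        · exact h6 u hu
        · exact fun hw => h ⟨hw, Or.inl h5⟩
      · refine Or.inr ⟨u, by omega, hr.trans h5, hwu, fun u' hu' hw => ?_⟩
        rcases hsucc u' hu' with hu' | rfl
        · exact h6 u' hu' hw
        · subst h5
          by_contra hlt
          exact h ⟨hw, Or.inr (by simpa using hlt)⟩

theorem assign_spec {s : Memory} {v u : ℕ} (hv : s.reg 21 = v + 1) (hu : s.reg 22 = u + 1) :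
    (∀ x, (assign.run s).arr 8 x 0 = if x = u then s.arr 8 u 0 + 1 else s.arr 8 x 0) ∧
    (∀ x, (assign.run s).arr 9 x 0 = if x = u then v + 1 else s.arr 9 x 0) ∧
    ∀ x, (assign.run s).arr 10 x 0 =
      if x = v then u + 1 else if s.arr 9 u 0 = x + 1 then 0 else s.arr 10 x 0 := by
  rw [assign, run_seq, run_ite]
  simp only [entry, holds_get, Expr.eval, hu, Nat.add_sub_cancel, run_seq, run_setArr, run_skip]
  split_ifs with h
  · refine ⟨fun x => ?_, fun x => ?_, fun x => ?_⟩
    · simp [Memory.arr_writeArr, Memory.reg_writeArr, hv, hu]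
    · simp [Memory.arr_writeArr, Memory.reg_writeArr, hv, hu]
    -- The truncated subtraction is exact here, since the object has an owner.
    · have : x = s.arr 9 u 0 - 1 ↔ s.arr 9 u 0 = x + 1 := by omega
      simp [Memory.arr_writeArr, Memory.reg_writeArr, hv, hu, this]
  · refine ⟨fun x => ?_, fun x => ?_, fun x => ?_⟩
    · simp [Memory.arr_writeArr, Memory.reg_writeArr, hv, hu]
    · simp [Memory.arr_writeArr, Memory.reg_writeArr, hv, hu]
    · have : s.arr 9 u 0 ≠ x + 1 := by omega
      simp [Memory.arr_writeArr, Memory.reg_writeArr, hv, hu, this]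

/-- The bidders of the auction. -/
def Bidder (s : Memory) (v : ℕ) : Prop := v < s.reg 0 ∧ s.arr 7 v 0 ≠ 0

/-- The objects wanted by the bidder `v`. -/
def Wants (s : Memory) (v u : ℕ) : Prop :=
  u < s.reg 0 ∧ s.arr 1 u 0 = 0 ∧ s.arr 7 u 0 = 0 ∧ s.arr 6 v u ≠ 0

/-- An attempt is idle in two cases: everybody is served, or the selected bidder wants nothing. The
second cannot occur when all bidders can be served. -/
theorem bid_spec (s : Memory) :
    ((bid.run s).arr = s.arr ∧ ((∀ v, Bidder s v → s.arr 10 v 0 ≠ 0) ∨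
      ∃ v, Bidder s v ∧ ∀ u, ¬ Wants s v u)) ∨
    ∃ v u, Bidder s v ∧ s.arr 10 v 0 = 0 ∧ Wants s v u ∧
      (∀ u', Wants s v u' → s.arr 8 u 0 ≤ s.arr 8 u' 0) ∧
      (∀ x, (bid.run s).arr 8 x 0 = if x = u then s.arr 8 u 0 + 1 else s.arr 8 x 0) ∧
      (∀ x, (bid.run s).arr 9 x 0 = if x = u then v + 1 else s.arr 9 x 0) ∧
      ∀ x, (bid.run s).arr 10 x 0 =
        if x = v then u + 1 else if s.arr 9 u 0 = x + 1 then 0 else s.arr 10 x 0 := by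
  rw [bid, run_seq, run_ite]
  have hsearch := search_reg (v := 11) (r := 21)
    (e := and (entry 7 (reg 11)) (not (entry 10 (reg 11)))) (by decide) (by decide) (by decide) s
  have h0 := run_reg (P := search 11 21 (and (entry 7 (reg 11)) (not (entry 10 (reg 11)))))
    (i := 0) (by decide) s
  have harr : ((search 11 21 (and (entry 7 (reg 11)) (not (entry 10 (reg 11))))).run s).arr =
    s.arr := funext fun a => run_arr (by simp [search, LoopProgram.arrs]) s
  generalize (search 11 21 (and (entry 7 (reg 11)) (not (entry 10 (reg 11))))).run s = s₁ at *
  simp only [holds_and, holds_not, entry, holds_get, Expr.eval, Memory.reg_writeReg,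
    Memory.arr_writeReg, if_true, not_not] at hsearch
  rcases hsearch with ⟨h21, hnone⟩ | ⟨v, hv, h21, h7, h10⟩
  · rw [if_neg (by simp [h21]), run_skip]
    exact Or.inl ⟨harr, Or.inl fun v hv h => hnone v hv.1 ⟨hv.2, h⟩⟩
  · rw [if_pos (by simp [h21]), run_seq, run_ite]
    have hc := cheapest_spec h21
    have hc0 := run_reg (P := cheapest) (i := 0) (by decide) s₁
    have hc21 := run_reg (P := cheapest) (i := 21) (by decide) s₁
    have hcarr : (cheapest.run s₁).arr = s₁.arr :=
      funext fun a => run_arr (by simp [cheapest, LoopProgram.arrs]) s₁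
    generalize cheapest.run s₁ = s₂ at *
    rw [harr, h0] at hc
    rcases hc with ⟨h22, hnone⟩ | ⟨u, hu, h22, hw, hmin⟩
    · rw [if_neg (by simp [h22]), run_skip]
      exact Or.inl ⟨hcarr.trans harr, Or.inr ⟨v, ⟨hv, h7⟩, fun u hu => hnone u hu.1 hu.2⟩⟩
    · rw [if_pos (by simp [h22])]
      have := assign_spec (hc21.trans h21) h22
      rw [hcarr, harr] at this
      exact Or.inr ⟨v, u, ⟨hv, h7⟩, h10, ⟨hu, hw⟩, fun u' hu' => hmin u' hu'.1 hu'.2, this⟩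

/-- Arrays `8`, `9`, `10` hold an auction state for bidders `L` and the relation `E`; if all bidders
can be served, then `j` bids have been made. -/
def AuctionInvariant (n : ℕ) (L : ℕ → Prop) (E : ℕ → ℕ → Prop) (j : ℕ) (s : Memory) : Prop :=
  IsAuctionState n L E (s.arr 8 · 0) (s.arr 9 · 0) (s.arr 10 · 0) ∧
    ((∃ q : ℕ → ℕ, (∀ v, L v → E v (q v) ∧ q v < n ∧ ¬ L (q v)) ∧
      ∀ v w, L v → L w → q v = q w → v = w) → AuctionProgress n L (s.arr 8 · 0) (s.arr 10 · 0) j)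

/-- An effective bid raises the sum of the prices by exactly one, and `exists_cheap` keeps the
raised price below `n`. -/
theorem AuctionInvariant.bid {s : Memory} {n j : ℕ} {L : ℕ → Prop} {E : ℕ → ℕ → Prop}
    (hn : s.reg 0 = n) (hL : Bidder s = L) (hE : Wants s = E) (h : AuctionInvariant n L E j s) :
    AuctionInvariant n L E (j + 1) (bid.run s) := by
  subst hn hL hE
  obtain ⟨hst, hpr⟩ := h
  rcases bid_spec s with ⟨harr, hcase⟩ | ⟨v, u, hv, hav, hu, hmin, h8, h9, h10⟩
  · unfold AuctionInvariant
    rw [harr]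
    refine ⟨hst, fun hq => ⟨(hpr hq).1, Or.inl ?_⟩⟩
    rcases hcase with h | ⟨v, hv, h⟩
    · exact h
    · obtain ⟨q, hq, -⟩ := hq
      exact absurd (hq v hv).1 (h _)
  · unfold AuctionInvariant
    simp only [funext h8, funext h9, funext h10]
    refine ⟨hst.bid (fun v u h => h.1) hv hav hu hmin, fun hq => ⟨?_, Or.inr ?_⟩⟩
    · obtain ⟨q, hq1, hq2⟩ := id hq
      obtain ⟨u', hu', hlt⟩ := hst.exists_cheap (fun v h => h.1) hq1 hq2 hv hav
      intro x hx
      have h1 := hmin u' hu'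
      have h2 := (hpr hq).1 x hx
      dsimp only at h2 hlt ⊢
      split_ifs
      · omega
      · exact h2
    · have hsum := ((hpr hq).2).resolve_left fun h => h v hv hav
      have hun : u ∈ Finset.range (s.reg 0) := Finset.mem_range.2 hu.1
      rw [← Finset.add_sum_erase _ _ hun] at hsum ⊢
      rw [if_pos rfl, Finset.sum_congr rfl fun x hx => if_neg (Finset.ne_of_mem_erase hx)]
      omega

theorem auction_spec {s : Memory} (h : ∀ x < s.reg 0,
    s.arr 8 x 0 = 0 ∧ s.arr 9 x 0 = 0 ∧ s.arr 10 x 0 = 0) :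
    AuctionInvariant (s.reg 0) (Bidder s) (Wants s) (s.reg 0 * s.reg 0) (auction.run s) := by
  refine run_loop_induction (i := 14) (P := loop 15 Solver.bid) (s := s)
    -- After `k` complete inner loops, `k * n` bids have been attempted.
    (fun k s' => AuctionInvariant (s.reg 0) (Bidder s) (Wants s) (k * s.reg 0) s') ?_ ?_
  · have hz : ∀ v u, Bidder s v → s.arr 10 v 0 ≠ u + 1 := fun v u hv => by
      have := (h v hv.1).2.2
      omega
    refine ⟨⟨fun v u hv h => absurd h (hz v u hv), fun v u hu ho => ?_, fun u hu hp => ?_,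
      fun v u hv h => absurd h (hz v u hv)⟩, fun _ => ⟨fun u hu => ?_, Or.inr ?_⟩⟩
    · have := (h u hu).2.1
      simp only [Memory.arr_writeReg] at ho
      omega
    · exact absurd (h u hu).1 hp
    · have := (h u hu).1
      simp only [Memory.arr_writeReg]
      omega
    · rw [zero_mul]
      exact Finset.sum_eq_zero fun u hu => (h u (Finset.mem_range.1 hu)).1
  · intro k s' _ _ hs' hI
    have h0' : s'.reg 0 = s.reg 0 := hs'.1 0 (by decide)
    have := run_loop_induction (i := 15) (P := Solver.bid) (s := s')
      (fun j s'' => AuctionInvariant (s.reg 0) (Bidder s) (Wants s) (k * s.reg 0 + j) s'') hI ?_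
    · rw [h0', ← Nat.succ_mul] at this
      exact this
    · intro j s'' _ _ hs'' hI'
      have h0 : s''.reg 0 = s.reg 0 := (hs''.1 0 (by decide)).trans h0'
      have h1 : s''.arr 1 = s.arr 1 := (hs''.2 1 (by decide)).trans (hs'.2 1 (by decide))
      have h6 : s''.arr 6 = s.arr 6 := (hs''.2 6 (by decide)).trans (hs'.2 6 (by decide))
      have h7 : s''.arr 7 = s.arr 7 := (hs''.2 7 (by decide)).trans (hs'.2 7 (by decide))
      refine hI'.bid h0 ?_ ?_
      · funext v; simp only [Bidder, h0, h7]
      · funext v u; simp only [Wants, h0, h1, h6, h7]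

/-! ### Correctness of the search for a valid set -/

section Spec

variable {n : ℕ} {G : SimpleGraph (Fin n)} {s : Memory}

/-- Array `0` holds the adjacency matrix of `G`. -/
structure HoldsGraph (G : SimpleGraph (Fin n)) (s : Memory) : Prop where
  reg_zero : s.reg 0 = n
  adj : ∀ u v : Fin n, s.arr 0 u v ≠ 0 ↔ G.Adj u v

/-- The vertices that are present. -/
def presentSet (n : ℕ) (s : Memory) : Finset (Fin n) :=
  Finset.univ.filter fun v => s.arr 1 v 0 = 0

theorem mem_presentSet {v : Fin n} : v ∈ presentSet n s ↔ s.arr 1 v 0 = 0 := by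
  simp [presentSet]

theorem dominance_spec (h : HoldsGraph G s) (v u : Fin n) (hv : v ∈ presentSet n s)
    (hu : u ∈ presentSet n s) :
    (dominance.run s).arr 6 v u ≠ 0 ↔ NbhdLE G (presentSet n s) v u := by
  rw [dominance, tabulate₂_arr (by decide) (by decide) (by decide) s (by rw [h.1]; exact v.2)
    (by rw [h.1]; exact u.2), h.1]
  have : ∀ x : Fin n, Expr.Holds (((s.writeReg 11 v).writeReg 12 u).writeReg 13 x)
      (imp (and (present (reg 13)) (or (eq (reg 13) (reg 11)) (get 0 (reg 11) (reg 13))))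
        (or (eq (reg 13) (reg 12)) (get 0 (reg 12) (reg 13)))) ↔
      (x ∈ presentSet n s → (x = v ∨ G.Adj v x) → (x = u ∨ G.Adj u x)) := by
    intro x
    simp only [holds_imp, holds_and, holds_or, holds_eq, holds_get, holds_not, present, entry,
      Expr.eval, Memory.reg_writeReg, Memory.arr_writeReg, mem_presentSet, ← h.adj, Fin.ext_iff]
    simp
  unfold NbhdLE
  simp only [hv, hu, true_and]
  exact ⟨fun hall x => (this x).1 (hall x x.2), fun hall x hx => (this ⟨x, hx⟩).2 (hall ⟨x, hx⟩)⟩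

theorem representatives_spec (h : HoldsGraph G s)
    (h6 : ∀ v ∈ presentSet n s, ∀ u ∈ presentSet n s,
      s.arr 6 v u ≠ 0 ↔ NbhdLE G (presentSet n s) v u) (v : Fin n) :
    (representatives.run s).arr 7 v 0 ≠ 0 ↔ v ∈ presentSet n s ∧ ∀ x ∈ presentSet n s,
      NbhdLE G (presentSet n s) x v → NbhdLE G (presentSet n s) v x ∧ v ≤ x := by
  rw [representatives, tabulate_arr (by decide) (by decide) (by decide) s
    (by rw [h.1]; exact v.2), h.1]
  simp only [holds_imp, holds_and, holds_le, holds_get, holds_not, present, entry,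
    Expr.eval, Memory.reg_writeReg, Memory.arr_writeReg, not_not]
  constructor
  · intro hall
    have hv : v ∈ presentSet n s := mem_presentSet.2 (hall v v.2).1
    refine ⟨hv, fun x hx hxv => ?_⟩
    have := (hall x x.2).2 ⟨mem_presentSet.1 hx, (h6 x hx v hv).2 hxv⟩
    exact ⟨(h6 v hv x hx).1 this.1, this.2⟩
  · rintro ⟨hv, hall⟩ x hx
    refine ⟨mem_presentSet.1 hv, fun hxv => ?_⟩
    have hxW : (⟨x, hx⟩ : Fin n) ∈ presentSet n s := mem_presentSet.2 hxv.1
    have := hall ⟨x, hx⟩ hxW ((h6 ⟨x, hx⟩ hxW v hv).1 hxv.2)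
    exact ⟨(h6 v hv ⟨x, hx⟩ hxW).2 this.1, this.2⟩

/-- The least vertices of the minimal twin classes form a transversal. -/
theorem isTransversal_of_least {W L : Finset (Fin n)}
    (hL : ∀ v, v ∈ L ↔ v ∈ W ∧ ∀ x ∈ W, NbhdLE G W x v → NbhdLE G W v x ∧ v ≤ x) :
    IsTransversal G W L := by
  classical
  refine ⟨fun v hv => ((hL v).1 hv).1, fun x hx => ?_, fun v hv w hw hvw => ?_⟩
  · -- Among the vertices with the smallest neighbourhoods below `x`, take the least one.
    let below : Fin n → Finset (Fin n) := fun v => W.filter fun y => NbhdLE G W y v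
    have hbelow : ∀ y v, NbhdLE G W y v → below y ⊆ below v := by
      intro y v hyv z hz
      simp only [below, Finset.mem_filter] at hz ⊢
      exact ⟨hz.1, hz.2.trans hyv⟩
    obtain ⟨m, hm, hmin⟩ := Finset.exists_min_image (below x) (fun v => (below v).card)
      ⟨x, by simpa [below, hx] using NbhdLE.refl hx⟩
    have hmx : NbhdLE G W m x := (Finset.mem_filter.1 hm).2
    have hge : ∀ y, NbhdLE G W y m → NbhdLE G W m y := by
      intro y hy
      have h1 : y ∈ below x := Finset.mem_filter.2 ⟨hy.1, hy.trans hmx⟩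
      have h2 := Finset.eq_of_subset_of_card_le (hbelow y m hy) (hmin y h1)
      have h3 : m ∈ below m := Finset.mem_filter.2 ⟨hmx.1, .refl hmx.1⟩
      rw [← h2] at h3
      exact (Finset.mem_filter.1 h3).2
    obtain ⟨v, hv, hleast⟩ := Finset.exists_min_image (below m) id
      ⟨m, Finset.mem_filter.2 ⟨hmx.1, .refl hmx.1⟩⟩
    have hvm : NbhdLE G W v m := (Finset.mem_filter.1 hv).2
    refine ⟨v, (hL v).2 ⟨hvm.1, fun y hy hyv => ?_⟩, hvm.trans hmx⟩
    have hym := hyv.trans hvm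
    exact ⟨hvm.trans (hge y hym), hleast y (Finset.mem_filter.2 ⟨hy, hym⟩)⟩
  · obtain ⟨h1, h2⟩ := ((hL w).1 hw).2 v ((hL v).1 hv).1 hvw
    exact le_antisymm (((hL v).1 hv).2 w ((hL w).1 hw).1 h1).2 h2

theorem reset_spec (s : Memory) : ∀ x < s.reg 0, (reset.run s).arr 8 x 0 = 0 ∧
    (reset.run s).arr 9 x 0 = 0 ∧ (reset.run s).arr 10 x 0 = 0 := by
  intro x hx
  have hx1 : x < ((update 11 8 (const 1) (const 0)).run s).reg 0 := by
    rwa [run_reg (by decide)]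
  have hx2 : x < ((update 11 9 (const 1) (const 0)).run
      ((update 11 8 (const 1) (const 0)).run s)).reg 0 := by
    rwa [run_reg (by decide)]
  simp only [reset, run_seq]
  refine ⟨?_, ?_, ?_⟩
  · rw [run_arr (by decide), run_arr (by decide), update_arr (by decide) (by decide)]
    simp [hx, Expr.eval]
  · rw [run_arr (by decide), update_arr (by decide) (by decide)]
    simp [hx1, Expr.eval]
  · rw [update_arr (by decide) (by decide)]
    simp [hx2, Expr.eval]

theorem verify_spec (h : HoldsGraph G s) :
    (verify.run s).reg 3 ≠ 0 ↔ (∀ v : Fin n, s.arr 7 v 0 ≠ 0 → s.arr 10 v 0 ≠ 0) ∧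
      (∀ v ∈ presentSet n s, s.arr 7 v 0 = 0 → s.arr 9 v 0 ≠ 0) ∧
      ∀ v w : Fin n, s.arr 7 v 0 ≠ 0 → s.arr 7 w 0 ≠ 0 → ¬ G.Adj v w := by
  rw [verify, run_seq, testAll_reg (by decide) (by decide) (by decide), run_reg (by decide), h.1]
  have key : ∀ v < n, (Expr.Holds ((Memory.writeReg (run (tabulate 11 13 20 11
      (and (imp (entry 7 (reg 11)) (entry 10 (reg 11)))
        (and (imp (and (present (reg 11)) (not (entry 7 (reg 11)))) (entry 9 (reg 11)))
          (not (and (entry 7 (reg 11)) (and (entry 7 (reg 13)) (get 0 (reg 11) (reg 13)))))))) s)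
            13 v)) (entry 11 (reg 13))) ↔ ∀ w < n, (s.arr 7 v 0 ≠ 0 → s.arr 10 v 0 ≠ 0) ∧
      (s.arr 1 v 0 = 0 → s.arr 7 v 0 = 0 → s.arr 9 v 0 ≠ 0) ∧
      (s.arr 7 v 0 ≠ 0 → s.arr 7 w 0 ≠ 0 → s.arr 0 v w = 0) := by
    intro v hv
    rw [holds_entry]
    simp only [Expr.eval, Memory.reg_writeReg, if_true, Memory.arr_writeReg]
    rw [tabulate_arr (by decide) (by decide) (by decide) s (by rwa [h.1]), h.1]
    refine forall₂_congr fun w _ => ?_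
    simp only [holds_imp, holds_and, holds_get, holds_not, present, entry,
      Expr.eval, Memory.reg_writeReg, Memory.arr_writeReg]
    simp
  have hif : ∀ p : Prop, ∀ [Decidable p], (if p then 1 else 0) ≠ 0 ↔ p := by
    intro p _; split_ifs <;> simp [*]
  rw [hif]
  constructor
  · intro hall
    refine ⟨fun v => ?_, fun v hv => ?_, fun v w hv hw => ?_⟩
    · exact (((key v v.2).1 (hall v v.2)) v v.2).1
    · exact (((key v v.2).1 (hall v v.2)) v v.2).2.1 (mem_presentSet.1 hv)
    · rw [← h.adj, not_not]
      exact (((key v v.2).1 (hall v v.2)) w w.2).2.2 hv hw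
  · rintro ⟨h1, h2, h3⟩ v hv
    refine (key v hv).2 fun w hw => ⟨h1 ⟨v, hv⟩, fun h => h2 ⟨v, hv⟩ (mem_presentSet.2 h), ?_⟩
    intro hv' hw'
    have := h3 ⟨v, hv⟩ ⟨w, hw⟩ hv' hw'
    rwa [← h.adj, not_not] at this

end Spec

section Spec

variable {n : ℕ} {G : SimpleGraph (Fin n)} {s : Memory}

theorem HoldsGraph.run (h : HoldsGraph G s) {P : LoopProgram} (hr : 0 ∉ P.regs)
    (ha : 0 ∉ P.arrs) : HoldsGraph G (P.run s) :=
  ⟨by rw [run_reg hr, h.1], fun u v => by rw [run_arr ha, h.2]⟩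

theorem presentSet_run {P : LoopProgram} (ha : 1 ∉ P.arrs) :
    presentSet n (P.run s) = presentSet n s := by
  simp only [presentSet, run_arr ha]

/-- The representatives form a transversal `L`. If some valid set exists, then `L` is valid, the
auction serves all of it and the final test succeeds. Conversely, the conditions tested make `L`
valid, with the assigned objects as parents. -/
theorem matching_spec (h : HoldsGraph G s) :
    ((matching.run s).reg 3 = 0 → ¬ ∃ L, IsValid G (presentSet n s) L) ∧
    ((matching.run s).reg 3 ≠ 0 → ∃ (L : Finset (Fin n)) (p : Fin n → Fin n),
      IsValid G (presentSet n s) L ∧ Set.InjOn p (L : Set (Fin n)) ∧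
      (∀ v ∈ L, p v ∉ L ∧ IsCandidateParent G (presentSet n s) (p v) v) ∧
      (∀ v, v ∈ L ↔ (matching.run s).arr 7 v 0 ≠ 0) ∧
      ∀ v ∈ L, (matching.run s).arr 10 v 0 = p v + 1) := by
  have hd := fun v hv u hu => dominance_spec h v u hv hu
  have h₁ := h.run (P := dominance) (by decide) (by decide)
  have hW₁ : presentSet n (dominance.run s) = presentSet n s := presentSet_run (by decide)
  simp only [matching, run_seq]
  generalize dominance.run s = s₁ at *
  rw [← hW₁] at hd ⊢
  have hrep := representatives_spec h₁ hd
  have h₂ := h₁.run (P := representatives) (by decide) (by decide)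
  have hW₂ : presentSet n (representatives.run s₁) = presentSet n s₁ := presentSet_run (by decide)
  have h6₂ := run_arr (P := representatives) (a := 6) (by decide) s₁
  generalize representatives.run s₁ = s₂ at *
  rw [← hW₂, ← h6₂] at hd
  rw [← hW₂] at hrep ⊢
  have hres := reset_spec s₂
  have h₃ := h₂.run (P := reset) (by decide) (by decide)
  have hW₃ : presentSet n (reset.run s₂) = presentSet n s₂ := presentSet_run (by decide)
  have h6₃ := run_arr (P := reset) (a := 6) (by decide) s₂
  have h7₃ := run_arr (P := reset) (a := 7) (by decide) s₂
  rw [h₂.1, ← h₃.1] at hres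
  generalize reset.run s₂ = s₃ at *
  rw [← hW₃, ← h6₃] at hd
  rw [← hW₃, ← h7₃] at hrep
  rw [← hW₃]
  have hauc := auction_spec hres
  have h₄ := h₃.run (P := auction) (by decide) (by decide)
  have hW₄ : presentSet n (auction.run s₃) = presentSet n s₃ := presentSet_run (by decide)
  have h7₄ := run_arr (P := auction) (a := 7) (by decide) s₃
  generalize auction.run s₃ = s₄ at *
  have hver := verify_spec h₄
  rw [hW₄, h7₄] at hver
  rw [run_arr (P := verify) (a := 7) (by decide), run_arr (P := verify) (a := 10) (by decide), h7₄]
  generalize verify.run s₄ = s₅ at *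
  clear hW₁ hW₂ hW₃ hW₄ h6₂ h6₃ h7₃ h7₄ h₁ h₂ h₄ h
  set W := presentSet n s₃ with hWdef
  let L : Finset (Fin n) := Finset.univ.filter fun v => s₃.arr 7 v 0 ≠ 0
  have hL : ∀ v, v ∈ L ↔ s₃.arr 7 v 0 ≠ 0 := fun v => by simp [L]
  have hT : IsTransversal G W L := isTransversal_of_least fun v => (hL v).trans (hrep v)
  have hbid : ∀ v : Fin n, Bidder s₃ v ↔ v ∈ L := fun v => by
    rw [hL, Bidder, h₃.1]; simp
  have hwant : ∀ v ∈ L, ∀ u : Fin n, Wants s₃ v u ↔ u ∈ W ∧ u ∉ L ∧ NbhdLE G W v u := by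
    intro v hv u
    rw [Wants, h₃.1, hL, not_not, hWdef, mem_presentSet]
    refine ⟨fun ⟨_, h1, h7, h6⟩ => ⟨h1, h7, (hd v (hT.subset hv) u (mem_presentSet.2 h1)).1 h6⟩,
      fun ⟨h1, h7, h6⟩ => ⟨u.2, h1, h7, (hd v (hT.subset hv) u (mem_presentSet.2 h1)).2 h6⟩⟩
  obtain ⟨hst, hpr⟩ := hauc
  -- Ownership records the bidder of each assigned object, which makes the assignment injective.
  have hserved : (∀ v ∈ L, s₄.arr 10 v 0 ≠ 0) → ∃ p : Fin n → Fin n,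
      Set.InjOn p (L : Set (Fin n)) ∧
      ∀ v ∈ L, (p v ∉ L ∧ IsCandidateParent G W (p v) v) ∧ s₄.arr 10 v 0 = p v + 1 ∧
        s₄.arr 9 (p v) 0 = v + 1 := by
    intro hall
    have : ∀ v ∈ L, ∃ u : Fin n, (u ∉ L ∧ IsCandidateParent G W u v) ∧ s₄.arr 10 v 0 = u + 1 ∧
        s₄.arr 9 u 0 = v + 1 := by
      intro v hv
      obtain ⟨u, hu⟩ := Nat.exists_eq_succ_of_ne_zero (hall v hv)
      obtain ⟨hw, ho⟩ := hst.assigned v u ((hbid v).2 hv) hu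
      have hun : u < n := h₃.1 ▸ hw.1
      obtain ⟨h1, h2, h3⟩ := (hwant v hv ⟨u, hun⟩).1 hw
      refine ⟨⟨u, hun⟩, ⟨h2, isCandidateParent_iff.2 ⟨fun h => h2 (h ▸ hv), h3⟩⟩, hu, ho⟩
    choose! p hp using this
    refine ⟨p, fun v hv w hw hvw => ?_, hp⟩
    have h1 := (hp v hv).2.2
    have h2 := (hp w hw).2.2
    rw [hvw, h2] at h1
    exact Fin.ext (by omega)
  constructor
  · rintro h3 ⟨L', hL'⟩
    have hval := hT.isValid hL'
    refine hver.2 ?_ h3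
    obtain ⟨hLW, -, hcard, hind, q, hq, hqL⟩ := hval
    have hall : ∀ v ∈ L, s₄.arr 10 v 0 ≠ 0 := by
      -- The parents in the valid set show that all bidders can be served. The auction is stated
      -- over `ℕ`, and the value outside `Fin n` is irrelevant.
      have hprog := hpr ⟨fun v => if hv : v < n then q ⟨v, hv⟩ else v, ?_, ?_⟩
      · exact fun v hv => hprog.all_served (fun v h => h.1) v ((hbid v).2 hv)
      · intro v hv
        have hvn : v < n := h₃.1 ▸ hv.1
        have hvL := (hbid ⟨v, hvn⟩).1 hv
        obtain ⟨h1, h2⟩ := hqL _ hvL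
        simp only [hvn, dif_pos]
        exact ⟨(hwant _ hvL _).2 ⟨h2.1, h1, h2.nbhdLE⟩, by rw [h₃.1]; exact (q _).2,
          (hbid _).not.2 h1⟩
      · intro v w hv hw hvw
        have hvn : v < n := h₃.1 ▸ hv.1
        have hwn : w < n := h₃.1 ▸ hw.1
        simp only [hvn, hwn, dif_pos] at hvw
        exact Fin.ext_iff.1 (hq ((hbid ⟨v, hvn⟩).1 hv) ((hbid ⟨w, hwn⟩).1 hw) (Fin.ext hvw))
    obtain ⟨p, hp, hpL⟩ := hserved hall
    refine ⟨fun v hv => hall v ((hL v).2 hv), fun u hu hu7 => ?_,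
      fun v w hv hw => hind v ((hL v).2 hv) w ((hL w).2 hw)⟩
    -- The parents found by the auction may differ from `q`, but by counting they also exhaust `W \
    -- L`.
    obtain ⟨v, hv, rfl⟩ := IsValid.exists_child hLW hcard hp (fun v hv => (hpL v hv).1) hu
      (fun h => (hL u).1 h hu7)
    rw [(hpL v hv).2.2]
    omega
  · intro h3
    obtain ⟨h10, h9, hind⟩ := hver.1 h3
    obtain ⟨p, hp, hpL⟩ := hserved fun v hv => h10 v ((hL v).1 hv)
    -- The ownership test gives surjectivity onto `W \ L`, and hence that `L` is half of `W`.
    have himage : L.image p = W \ L := by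
      ext u
      rw [Finset.mem_image, Finset.mem_sdiff]
      constructor
      · rintro ⟨v, hv, rfl⟩
        exact ⟨(hpL v hv).1.2.1, (hpL v hv).1.1⟩
      · rintro ⟨hu, huL⟩
        obtain ⟨v, hv⟩ := Nat.exists_eq_succ_of_ne_zero
          (h9 u hu (not_not.1 fun h => huL ((hL u).2 h)))
        obtain ⟨hb, ha⟩ := hst.owned v u (by rw [h₃.1]; exact u.2) hv
        have hvn : v < n := h₃.1 ▸ hb.1
        have hvL := (hbid ⟨v, hvn⟩).1 hb
        have := (hpL _ hvL).2.1
        dsimp only at this ha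
        exact ⟨⟨v, hvn⟩, hvL, Fin.ext (by omega)⟩
    have hcard := congrArg Finset.card himage
    rw [Finset.card_image_of_injOn hp, Finset.card_sdiff_of_subset hT.subset] at hcard
    have hle := Finset.card_le_card hT.subset
    exact ⟨L, p, ⟨hT.subset, fun v hv => ⟨_, (hpL v hv).1.2⟩, by omega,
      fun v hv w hw => hind v w ((hL v).1 hv) ((hL w).1 hw), p, hp, fun v hv => (hpL v hv).1⟩,
      hp, fun v hv => (hpL v hv).1, hL, fun v hv => (hpL v hv).2.1⟩

theorem record_spec (s : Memory) :
    (record.run s).reg 4 = s.reg 4 - 1 ∧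
    (∀ v < s.reg 0, (record.run s).arr 1 v 0 =
      if s.arr 7 v 0 ≠ 0 then s.reg 4 else s.arr 1 v 0) ∧
    (∀ v < s.reg 0, (record.run s).arr 2 v 0 =
      if s.arr 7 v 0 ≠ 0 then s.arr 10 v 0 - 1 else s.arr 2 v 0) ∧
    ∀ v < s.reg 0, ∀ w < s.reg 0, (record.run s).arr 3 v w =
      if s.arr 7 v 0 ≠ 0 ∧ s.arr 1 w 0 = 0 ∧ s.arr 0 v w ≠ 0 then 1 else s.arr 3 v w := by
  simp only [record, run_seq]
  have h1 := update_arr (v := 11) (a := 2) (e := entry 7 (reg 11))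
    (e' := sub (entry 10 (reg 11)) (const 1)) (by decide) (by decide) s
  have a1 := (update 11 2 (entry 7 (reg 11)) (sub (entry 10 (reg 11)) (const 1))).agreeOff_run s
  generalize (update 11 2 (entry 7 (reg 11)) (sub (entry 10 (reg 11)) (const 1))).run s = s₁ at *
  have h2 := update₂_arr (v := 11) (u := 12) (a := 3) (e := and (entry 7 (reg 11))
    (and (present (reg 12)) (get 0 (reg 11) (reg 12)))) (e' := const 1) (by decide) (by decide)
    (by decide) s₁
  have a2 := (update₂ 11 12 3 (and (entry 7 (reg 11))
    (and (present (reg 12)) (get 0 (reg 11) (reg 12)))) (const 1)).agreeOff_run s₁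
  generalize (update₂ 11 12 3 (and (entry 7 (reg 11))
    (and (present (reg 12)) (get 0 (reg 11) (reg 12)))) (const 1)).run s₁ = s₂ at *
  have h3 := update_arr (v := 11) (a := 1) (e := entry 7 (reg 11)) (e' := reg 4) (by decide)
    (by decide) s₂
  have a3 := (update 11 1 (entry 7 (reg 11)) (reg 4)).agreeOff_run s₂
  generalize (update 11 1 (entry 7 (reg 11)) (reg 4)).run s₂ = s₃ at *
  have r0₁ : s₁.reg 0 = s.reg 0 := a1.1 0 (by decide)
  have r0₂ : s₂.reg 0 = s.reg 0 := (a2.1 0 (by decide)).trans r0₁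
  have r4₂ : s₂.reg 4 = s.reg 4 := (a2.1 4 (by decide)).trans (a1.1 4 (by decide))
  have r4₃ : s₃.reg 4 = s.reg 4 := (a3.1 4 (by decide)).trans r4₂
  have t7₁ : s₁.arr 7 = s.arr 7 := a1.2 7 (by decide)
  have t1₁ : s₁.arr 1 = s.arr 1 := a1.2 1 (by decide)
  have t0₁ : s₁.arr 0 = s.arr 0 := a1.2 0 (by decide)
  have t3₁ : s₁.arr 3 = s.arr 3 := a1.2 3 (by decide)
  have t7₂ : s₂.arr 7 = s.arr 7 := (a2.2 7 (by decide)).trans t7₁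
  have t1₂ : s₂.arr 1 = s.arr 1 := (a2.2 1 (by decide)).trans t1₁
  have t2₂ : s₂.arr 2 = s₁.arr 2 := a2.2 2 (by decide)
  have t2₃ : s₃.arr 2 = s₂.arr 2 := a3.2 2 (by decide)
  have t3₃ : s₃.arr 3 = s₂.arr 3 := a3.2 3 (by decide)
  simp only [run_setReg, Memory.arr_writeReg, Memory.reg_writeReg, if_true, Expr.eval, r4₃]
  refine ⟨trivial, fun v hv => ?_, fun v hv => ?_, fun v hv w hw => ?_⟩
  · rw [h3]
    simp [holds_entry, Expr.eval, Memory.reg_writeReg, Memory.arr_writeReg, r0₂, r4₂, t7₂, t1₂, hv]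
  · rw [t2₃, t2₂, h1]
    simp [entry, Expr.eval, Memory.reg_writeReg, Memory.arr_writeReg, hv]
  · rw [t3₃, h2]
    simp [holds_entry, present, Expr.eval, Memory.reg_writeReg, Memory.arr_writeReg, r0₁, t7₁,
      t1₁, t0₁, t3₁, hv, hw]

/-! ### One round, and its invariant -/

/-- With `k` slots left to compute, the slots `post` have been found and recorded. -/
structure Stage (G : SimpleGraph (Fin n)) (δ k : ℕ) (post : List (Slot (Fin n))) (s : Memory) :
    Prop where
  holdsGraph : HoldsGraph G s
  reg_two : s.reg 2 = δ
  reg_three : s.reg 3 ≠ 0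
  reg_four : s.reg 4 = k
  length : k + post.length = δ
  card : (presentSet n s).card = 2 ^ k
  -- Continuation form: the later slots are found first, so any answer for the remaining graph must
  -- extend to an answer for `G`.
  fastGrowth : ∀ out, FastGrowth G k (presentSet n s) out → FastGrowth G δ Finset.univ
    (out.map fun σ => ⟨σ.initiator, σ.slots ++ post⟩)
  births : ∀ (t : ℕ) (ht : t < post.length) (u v : Fin n) (A : Finset (Fin n)),
    (u, v, A) ∈ post[t].births ↔
      s.arr 1 v 0 = k + t + 1 ∧ s.arr 2 v 0 = u ∧ ∀ w : Fin n, w ∈ A ↔ s.arr 3 v w = 1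
  deleted : ∀ S ∈ post, S.deleted = ∅
  -- Recorded slot numbers exceed `k`, so the number used in the next round is new.
  birth_slot : ∀ v : Fin n, s.arr 1 v 0 = 0 ∨ k < s.arr 1 v 0
  -- Blank rows ensure that a row filled at a birth contains nothing but the edges activated then.
  arr_three : ∀ v ∈ presentSet n s, ∀ w : Fin n, s.arr 3 v w = 0
  arr_four : s.arr 4 = 0

theorem Stage.congr {δ k : ℕ} {post : List (Slot (Fin n))} {s' : Memory}
    (h : Stage G δ k post s) (hr : ∀ i ∈ [0, 2, 3, 4], s'.reg i = s.reg i) (ha : s'.arr = s.arr) :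
    Stage G δ k post s' := by
  simp only [List.mem_cons, List.not_mem_nil, or_false, forall_eq_or_imp, forall_eq] at hr
  obtain ⟨r0, r2, r3, r4⟩ := hr
  have hW : presentSet n s' = presentSet n s := by simp only [presentSet, ha]
  obtain ⟨⟨h1, h2⟩, h3, h4, h5, h6, h7, h8, h9, h10, h11, h12, h13⟩ := h
  constructor
  · exact ⟨r0.trans h1, ha ▸ h2⟩
  · exact r2.trans h3
  · exact r3 ▸ h4
  · exact r4.trans h5
  · exact h6
  · exact hW ▸ h7
  · exact hW ▸ h8
  · exact ha ▸ h9
  · exact h10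
  · exact ha ▸ h11
  · exact hW ▸ ha ▸ h12
  · exact ha ▸ h13

/-- On success the slot recorded is the one for the matching with pairs `(p v, v)` and the all-true
assignment. On failure no valid set exists, so either there is no candidate matching or the formula
of any such matching is unsatisfiable. -/
theorem Stage.round {δ k : ℕ} {post : List (Slot (Fin n))} (h : Stage G δ (k + 1) post s) :
    ((round.run s).reg 3 = 0 ∧ FastGrowth G δ Finset.univ none) ∨
      ∃ post', Stage G δ k post' (round.run s) := by
  classical
  obtain ⟨hfail, hsucc⟩ := matching_spec h.holdsGraph
  have hG := h.holdsGraph.run (P := matching) (by decide) (by decide)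
  have r2 := run_reg (P := matching) (i := 2) (by decide) s
  have r4 := run_reg (P := matching) (i := 4) (by decide) s
  have t1 := run_arr (P := matching) (a := 1) (by decide) s
  have t2 := run_arr (P := matching) (a := 2) (by decide) s
  have t3 := run_arr (P := matching) (a := 3) (by decide) s
  have t4 := run_arr (P := matching) (a := 4) (by decide) s
  rw [Solver.round, run_seq, run_ite]
  generalize matching.run s = s₁ at *
  split_ifs with h3
  · right
    obtain ⟨L, p, hval, hp, hpL, hL7, hL10⟩ := hsucc h3
    obtain ⟨hLW, -, hcard, -⟩ := id hval
    have hM := isCandidateMatching_of_parents hLW hcard hp hpL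
    set M : Fin L.card → Fin n × Fin n := fun i => (p (L.equivFin.symm i), L.equivFin.symm i)
    have hchosen : chosen M (fun _ => true) = L := by
      ext v
      rw [mem_chosen]
      simp only [childOf, if_true, M]
      exact ⟨fun ⟨i, hi⟩ => hi ▸ (L.equivFin.symm i).2,
        fun hv => ⟨L.equivFin ⟨v, hv⟩, by simp⟩⟩
    -- Clauses with a positive literal hold trivially. Negative unit clauses are absent because `p`
    -- gives candidate parents, and purely negative pairs because `L` is independent.
    have hτ : Satisfies (fun _ => true) (formula G (presentSet n s) M) := by
      rintro c ((((⟨i, rfl, h1, h2⟩ | ⟨i, rfl, h1, h2⟩) | ⟨i, j, rfl, h⟩) | ⟨i, j, rfl, h⟩) |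
        ⟨i, j, rfl, hij, h⟩)
      · exact absurd (hpL _ (L.equivFin.symm i).2).2 h2
      · simp
      · simp
      · exact absurd h (hval.2.2.2.1 _ (L.equivFin.symm i).2 _ (L.equivFin.symm j).2)
      · simp
    have hbirth : ∀ u v A, (u, v, A) ∈ (matchingSlot G (presentSet n s) M fun _ => true).births ↔
        v ∈ L ∧ p v = u ∧ ∀ w, w ∈ A ↔ w ∈ presentSet n s ∧ G.Adj v w := by
      intro u v A
      rw [mem_matchingSlot_births]
      simp only [childOf, parentOf, if_true, M]
      constructor
      · rintro ⟨i, rfl, rfl, hA⟩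
        exact ⟨(L.equivFin.symm i).2, rfl, hA⟩
      · rintro ⟨hv, rfl, hA⟩
        exact ⟨L.equivFin ⟨v, hv⟩, by simp, by simp, hA⟩
    obtain ⟨c4, c1, c2, c3⟩ := record_spec s₁
    have hG' := hG.run (P := record) (by decide) (by decide)
    have r2' := run_reg (P := record) (i := 2) (by decide) s₁
    have r3' := run_reg (P := record) (i := 3) (by decide) s₁
    have t4' := run_arr (P := record) (a := 4) (by decide) s₁
    rw [hG.1] at c1 c2 c3
    generalize record.run s₁ = s₂ at *
    replace c1 : ∀ v : Fin n, s₂.arr 1 v 0 = if v ∈ L then k + 1 else s.arr 1 v 0 := by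
      intro v
      rw [c1 v v.2, r4, h.reg_four, t1]
      simp only [hL7]
    replace c2 : ∀ v : Fin n, s₂.arr 2 v 0 = if v ∈ L then (p v : ℕ) else s.arr 2 v 0 := by
      intro v
      rw [c2 v v.2, t2]
      by_cases hv : v ∈ L
      · rw [if_pos hv, if_pos ((hL7 v).1 hv), hL10 v hv, Nat.add_sub_cancel]
      · rw [if_neg hv, if_neg ((hL7 v).not.1 hv)]
    replace c3 : ∀ v w : Fin n, s₂.arr 3 v w =
        if v ∈ L ∧ w ∈ presentSet n s ∧ G.Adj v w then 1 else s.arr 3 v w := by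
      intro v w
      rw [c3 v v.2 w w.2, t1, t3]
      simp only [hL7, mem_presentSet, hG.adj]
    have hW : presentSet n s₂ = presentSet n s \ L := by
      ext v
      rw [Finset.mem_sdiff, mem_presentSet, mem_presentSet, c1]
      split_ifs with hv <;> simp [hv]
    refine ⟨matchingSlot G (presentSet n s) M (fun _ => true) :: post, hG', ?_, ?_, ?_, ?_, ?_,
      ?_, ?_, ?_, ?_, ?_, ?_⟩
    · rw [r2', r2, h.reg_two]
    · rwa [r3']
    · rw [c4, r4, h.reg_four, Nat.add_sub_cancel]
    · rw [← h.length, List.length_cons]; omega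
    · have := h.card
      rw [hW, Finset.card_sdiff_of_subset hLW]
      rw [pow_succ] at this
      omega
    · intro out hout
      rw [hW, ← hchosen] at hout
      have := h.fastGrowth _ (FastGrowth.step k _ _ M _ out hM hτ hout)
      simpa [Option.map_map, Function.comp_def] using this
    · intro t ht u v A
      cases t with
      | zero =>
        rw [List.getElem_cons_zero, hbirth, c1, c2]
        by_cases hv : v ∈ L
        · have h3 : ∀ w : Fin n, s₂.arr 3 v w = 1 ↔ w ∈ presentSet n s ∧ G.Adj v w := by
            intro w
            rw [c3, h.arr_three v (hLW hv)]
            simp [hv]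
          simp [hv, h3, Fin.ext_iff]
        · simp only [hv, if_false, false_and, false_iff]
          have := h.birth_slot v
          omega
      | succ t =>
        rw [List.getElem_cons_succ, h.births t (by simpa using ht), c1, c2]
        -- A vertex recorded now was present before and so belongs to no later slot; its new number
        -- `k + 1` is also too small.
        by_cases hv : v ∈ L
        · have := mem_presentSet.1 (hLW hv)
          simp [hv, this]
        · have h3 : ∀ w : Fin n, s₂.arr 3 v w = s.arr 3 v w := fun w => by
            rw [c3, if_neg (fun h => hv h.1)]
          simp only [hv, if_false, h3]
          rw [show k + 1 + t + 1 = k + (t + 1) + 1 by omega]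
    · intro S hS
      rcases List.mem_cons.1 hS with rfl | hS
      · rfl
      · exact h.deleted S hS
    · intro v
      have := h.birth_slot v
      rw [c1]
      split_ifs <;> omega
    · intro v hv w
      rw [hW, Finset.mem_sdiff] at hv
      rw [c3, if_neg (fun h => hv.2 h.1), h.arr_three v hv.1]
    · rw [t4', t4, h.arr_four]
  · left
    have h3 : s₁.reg 3 = 0 := not_not.1 h3
    rw [run_skip]
    refine ⟨h3, h.fastGrowth none ?_⟩
    by_cases hM : ∃ (m : ℕ) (M : Fin m → Fin n × Fin n), IsCandidateMatching G (presentSet n s) M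
    · obtain ⟨m, M, hM⟩ := hM
      refine .unsatisfiable k _ m M hM ?_
      rintro ⟨τ, hτ⟩
      exact hfail h3 ⟨_, hM.isValid_chosen hτ⟩
    · exact .noMatching k _ hM

end Spec

/-! ### The complete run -/

theorem logarithm_spec {s : Memory} {δ : ℕ} (h0 : s.reg 0 = 2 ^ δ) (h2 : s.reg 2 = 0) :
    (logarithm.run s).reg 2 = δ ∧ (logarithm.run s).reg 4 = δ := by
  rw [logarithm, run_seq, run_seq, run_setReg, run_setReg]
  have hn : (s.writeReg 5 ((Expr.const 1).eval s)).reg 0 = 2 ^ δ := by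
    simp [Memory.reg_writeReg, h0]
  generalize hs₁ : s.writeReg 5 ((Expr.const 1).eval s) = s₁ at *
  have := run_loop_induction (i := 10) (P := ite (lt (reg 5) (reg 0))
      (seq (setReg 5 (add (reg 5) (reg 5))) (setReg 2 (add (reg 2) (const 1)))) skip) (s := s₁)
    -- Doubling stops at `2 ^ δ = n`, and `δ < 2 ^ δ` means that the loop is long enough to get
    -- there.
    (fun j s' => s'.reg 2 = min j δ ∧ s'.reg 5 = 2 ^ min j δ) ?_ ?_
  · rw [hn, min_eq_right Nat.lt_two_pow_self.le] at this
    simp [Memory.reg_writeReg, Expr.eval, this.1]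
  · rw [← hs₁]
    simp [Memory.reg_writeReg, Expr.eval, h2]
  · rintro j s' - - hs' ⟨hI2, hI5⟩
    have h0' : s'.reg 0 = 2 ^ δ := (hs'.1 0 (by decide)).trans hn
    rw [run_ite]
    simp only [holds_lt, Expr.eval, h0', hI5, Nat.pow_lt_pow_iff_right one_lt_two]
    split_ifs with hlt
    · have h1 : min j δ = j := by omega
      have h2 : min (j + 1) δ = j + 1 := by omega
      simp [run_seq, run_setReg, Memory.reg_writeReg, Expr.eval, hI2, hI5, h1, h2, pow_succ]
      omega
    · have h1 : min (j + 1) δ = min j δ := by omega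
      simp [run_skip, Memory.reg_writeReg, hI2, hI5, h1]

theorem stage_inputMemory (δ : ℕ) (G : SimpleGraph (Fin (2 ^ δ))) :
    Stage G δ δ [] ((seq logarithm (setReg 3 (const 1))).run (inputMemory G)) := by
  have h0 : (inputMemory G).reg 0 = 2 ^ δ := rfl
  obtain ⟨h2, h4⟩ := logarithm_spec h0 rfl
  have h0' := run_reg (P := logarithm) (i := 0) (by decide) (inputMemory G)
  have harr : (logarithm.run (inputMemory G)).arr = (inputMemory G).arr :=
    funext fun a => run_arr (by simp [logarithm, LoopProgram.arrs]) _
  rw [run_seq, run_setReg]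
  generalize logarithm.run (inputMemory G) = s at *
  have hpos : ∀ a ≠ 0, s.arr a = 0 := by
    intro a ha
    rw [harr]
    funext u v
    simp [inputMemory, ha]
  have hW : presentSet (2 ^ δ) (s.writeReg 3 ((const 1).eval s)) = Finset.univ := by
    ext v
    simp [mem_presentSet, Memory.arr_writeReg, hpos]
  constructor
  · refine ⟨by simp [Memory.reg_writeReg, h0', h0], fun u v => ?_⟩
    rw [Memory.arr_writeReg, harr]
    simp [inputMemory]
  · simp [Memory.reg_writeReg, h2]
  · simp [Memory.reg_writeReg, Expr.eval]
  · simp [Memory.reg_writeReg, h4]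
  · rfl
  · rw [hW]; simp
  · intro out hout
    rw [hW] at hout
    simpa using hout
  · intro t ht
    simp at ht
  · simp
  · intro v
    simp [Memory.arr_writeReg, hpos]
  · intro v _ w
    simp [Memory.arr_writeReg, hpos]
  · exact hpos 4 (by decide)

/-- After `j` iterations either a failure has been flagged or `δ - j` slots remain. Truncated
subtraction covers the idle iterations, and `δ < 2 ^ δ` ensures that all slots are treated. -/
theorem rounds_spec {δ : ℕ} {G : SimpleGraph (Fin (2 ^ δ))} {s : Memory}
    (hs : Stage G δ δ [] s) :
    let s' := (loop 10 (ite (and (reg 3) (reg 4)) round skip)).run s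
    (s'.reg 3 = 0 ∧ FastGrowth G δ Finset.univ none) ∨ ∃ post, Stage G δ 0 post s' := by
  have := run_loop_induction (i := 10) (P := ite (and (reg 3) (reg 4)) round skip) (s := s)
    (fun j s' => (s'.reg 3 = 0 ∧ FastGrowth G δ Finset.univ none) ∨
      ∃ post, Stage G δ (δ - j) post s') ?_ ?_
  · rw [hs.holdsGraph.reg_zero, Nat.sub_eq_zero_of_le Nat.lt_two_pow_self.le] at this
    exact this
  · exact Or.inr ⟨[], hs.congr (by simp [Memory.reg_writeReg]) rfl⟩
  · intro j s' _ _ _ hI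
    have hcongr : ∀ s'' : Memory, ((s''.reg 3 = 0 ∧ FastGrowth G δ Finset.univ none) ∨
        ∃ post, Stage G δ (δ - (j + 1)) post s'') →
        ((s''.writeReg 10 (j + 1)).reg 3 = 0 ∧ FastGrowth G δ Finset.univ none) ∨
        ∃ post, Stage G δ (δ - (j + 1)) post (s''.writeReg 10 (j + 1)) := fun s'' h =>
      h.imp (by simp [Memory.reg_writeReg]) fun ⟨post, h⟩ =>
        ⟨post, h.congr (by simp [Memory.reg_writeReg]) rfl⟩
    apply hcongr
    rw [run_ite]
    rcases hI with ⟨h3, h⟩ | ⟨post, h⟩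
    · rw [if_neg (by simp [h3]), run_skip]
      exact Or.inl ⟨h3, h⟩
    · have h4 := h.reg_four
      rcases hk : δ - j with _ | k
      · rw [if_neg (by simp [h4, hk]), run_skip]
        rw [hk] at h
        exact Or.inr ⟨post, by rwa [show δ - (j + 1) = 0 by omega]⟩
      · rw [if_pos (by simp [h.reg_three, h4, hk])]
        rw [hk] at h
        rw [show δ - (j + 1) = k by omega]
        exact h.round

theorem Stage.represents {n δ : ℕ} {G : SimpleGraph (Fin n)} {post : List (Slot (Fin n))}
    {s s' : Memory} (h : Stage G δ 0 post s) {u : Fin n} (h0 : s'.reg 0 = 1) (h1 : s'.reg 1 = u)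
    (h2 : s'.reg 2 = s.reg 2) (harr : s'.arr = s.arr) : Represents s' (some ⟨u, post⟩) := by
  refine ⟨h0, h1, ?_, fun t ht => ⟨fun v w A => ?_, fun v w => ?_⟩⟩
  · rw [h2, h.reg_two, ← h.length, zero_add]
  · rw [harr]
    simpa using h.births t ht v w A
  · rw [harr, h.arr_four, h.deleted _ (List.getElem_mem ht)]
    simp

/-- The program halts in polynomial time with an answer of the fast growth algorithm. -/
theorem program_spec (δ : ℕ) (G : SimpleGraph (Fin (2 ^ δ))) :
    ∃ (t : ℕ) (s : Memory) (out : Option (Schedule (Fin (2 ^ δ)))),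
      Exec program (inputMemory G) t s ∧ t ≤ (main.cost + 6).eval (2 ^ δ) ∧
      FastGrowth G δ Finset.univ out ∧ Represents s out := by
  obtain ⟨t, ht, hexec⟩ := exists_exec main_wellFormed zero_notMem_main_regs (inputMemory G)
  have hfinal := Exec.setReg 0 (not (not (reg 3))) (main.run (inputMemory G))
  have hreg0 : (inputMemory G).reg 0 = 2 ^ δ := rfl
  -- Evaluating the double negation takes 5 steps and the assignment one more, which explains the 6.
  have hcost : t + ((not (not (reg 3))).cost + 1) ≤ (main.cost + 6).eval (2 ^ δ) := by
    rw [hreg0] at ht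
    simp [Expr.cost, Expr.not]
    omega
  suffices h : ∃ out, FastGrowth G δ Finset.univ out ∧
      Represents ((main.run (inputMemory G)).writeReg
        0 ((not (not (reg 3))).eval (main.run (inputMemory G)))) out by
    obtain ⟨out, h1, h2⟩ := h
    exact ⟨_, _, out, Exec.seq hexec hfinal, hcost, h1, h2⟩
  have hrounds := rounds_spec (stage_inputMemory δ G)
  rw [show main.run (inputMemory G) = (setReg 1 (sub (reg 1) (const 1))).run
    ((search 11 1 (present (reg 11))).run ((loop 10 (ite (and (reg 3) (reg 4)) round skip)).run
      ((seq logarithm (setReg 3 (const 1))).run (inputMemory G)))) from rfl]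
  generalize (loop 10 (ite (and (reg 3) (reg 4)) round skip)).run
      ((seq logarithm (setReg 3 (const 1))).run (inputMemory G)) = s at *
  have harr : ((search 11 1 (present (reg 11))).run s).arr = s.arr :=
    funext fun a => run_arr (by simp [search, LoopProgram.arrs]) _
  have h3 := run_reg (P := search 11 1 (present (reg 11))) (i := 3) (by decide) s
  have h2 := run_reg (P := search 11 1 (present (reg 11))) (i := 2) (by decide) s
  have hsearch := search_reg (v := 11) (r := 1) (e := present (reg 11)) (by decide) (by decide)
    (by decide) s
  generalize (search 11 1 (present (reg 11))).run s = s' at *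
  rw [run_setReg]
  rcases hrounds with ⟨hfail, hnone⟩ | ⟨post, hstage⟩
  · refine ⟨none, hnone, ?_⟩
    simp [Represents, Memory.reg_writeReg, Expr.eval, Expr.not, h3, hfail]
  -- With no slots left exactly one vertex is present; the search must find it, and it is the
  -- initiator.
  · obtain ⟨u, hu⟩ := Finset.card_eq_one.1 (hstage.card.trans (pow_zero 2))
    have hmem : ∀ v : Fin (2 ^ δ), s.arr 1 v 0 = 0 ↔ v = u := fun v => by
      rw [← mem_presentSet, hu, Finset.mem_singleton]
    have h1 : s'.reg 1 = u + 1 := by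
      simp only [present, holds_not, holds_entry, Expr.eval, Memory.reg_writeReg, if_true,
        Memory.arr_writeReg, not_not, hstage.holdsGraph.reg_zero] at hsearch
      rcases hsearch with ⟨-, hnone⟩ | ⟨k, hk, h1, hk1⟩
      · exact absurd ((hmem u).2 rfl) (hnone u u.2)
      · rw [h1, ← (hmem ⟨k, hk⟩).1 hk1]
    have hout := hstage.fastGrowth (some ⟨u, []⟩) (hu ▸ .done u)
    refine ⟨_, hout, hstage.represents ?_ ?_ ?_ ?_⟩
    · have := hstage.reg_three
      simp [Memory.reg_writeReg, Expr.eval, Expr.not, h3]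
      omega
    · simp [Memory.reg_writeReg, Expr.eval, h1]
    · simp [Memory.reg_writeReg, h2]
    · exact harr

end Solver

end GraphGrowth

theorem mainTheorem3 :
    -- At every stage, the valid sets are found by a perfect matching and a 2-SAT formula.
    (∀ (V : Type) [DecidableEq V] (G : SimpleGraph V) (W : Finset V),
      (∀ (m : ℕ) (M : Fin m → V × V), IsCandidateMatching G W M →
        (∀ τ : Fin m → Bool, Satisfies τ (formula G W M) → IsValid G W (chosen M τ)) ∧
        ((∃ L : Finset V, IsValid G W L) → ∃ τ : Fin m → Bool, Satisfies τ (formula G W M))) ∧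
      ((∃ L : Finset V, IsValid G W L) →
        ∃ (m : ℕ) (M : Fin m → V × V), IsCandidateMatching G W M)) ∧
    -- All answers of the algorithm are correct, and it runs in polynomial time.
    ∃ (P : Program) (p : Polynomial ℕ), ∀ (δ : ℕ) (G : SimpleGraph (Fin (2 ^ δ))),
      (∀ out : Option (Schedule (Fin (2 ^ δ))),
        FastGrowth G δ Finset.univ out → IsCorrectAnswer G δ out) ∧
      ∃ (t : ℕ) (s : Memory) (out : Option (Schedule (Fin (2 ^ δ)))),
        Exec P (inputMemory G) t s ∧ t ≤ p.eval (2 ^ δ) ∧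
        FastGrowth G δ Finset.univ out ∧ Represents s out := by
  refine ⟨fun V _ G W => ⟨fun m M hM => ⟨fun τ hτ => hM.isValid_chosen hτ,
    fun ⟨L, hL⟩ => hL.exists_satisfies hM⟩, fun ⟨L, hL⟩ => hL.exists_isCandidateMatching⟩, ?_⟩
  exact ⟨Solver.program, Solver.main.cost + 6, fun δ G =>
    ⟨fun out h => h.isCorrectAnswer (Fintype.card_fin _), Solver.program_spec δ G⟩⟩
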